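/- Let $n\ge 2$, $T>0$, $\mathbb T=(\mathbb R/\mathbb Z)^n$. For a real (vector) distribution $g$ on $\mathbb T$ with Fourier coefficients $\hat g(\xi)=\langle g,e^{-2\pi i x\cdot\xi}\rangle$, $\xi\in\mathbb Z^n$, let $\|g\|_{H^s}^2=\sum_{\xi}\varrho(\xi)^{2s}|\hat g(\xi)|^2$ with $\varrho(\xi)=2\pi(1+|\xi|^2)^{1/2}$, and let $H^s$ be the space of those $g$ with finite norm; $\dot H^s$ is the subspace with $\hat g(0)=0$, and $\dot{\mathbf H}^s_\sigma$ is the space of divergence-free vector fields in $(\dot H^s)^n$. The dual product of $g\in H^{s}$, $h\in H^{-s}$ is $\langle g,h\rangle=\sum_\xi \hat g(\xi)\cdot\hat h(-\xi)$, and $\mathbb P_\sigma$ is the Leray projector onto mean-zero divergence-free fields. Let $a_{ij}^{\alpha\beta}\in L_\infty(\mathbb T\times(0,T))$ for $i,j,\alpha,\beta=1,\dots,n$, and (summing over repeated indices) $$a_{\mathbb T}(t;u,v)=\int_{\mathbb T}a_{ij}^{\alpha\beta}(x,t)E_{j\beta}(u)E_{i\alpha}(v)\,dx,\qquad E_{j\beta}(u)=\tfrac12(\partial_ju_\beta+\partial_\beta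 u_j).$$ Let $f\in L_2(0,T;\dot{\mathbf H}^{-1})$ and $u^0\in\dot{\mathbf H}^0_\sigma$. A weak solution is a function $u\in L_\infty(0,T;\dot{\mathbf H}^0_\sigma)\cap L_2(0,T;\dot{\mathbf H}^1_\sigma)$ such that, with $u'$ its distributional time derivative, $$\langle u'(t)+\mathbb P_\sigma[(u(t)\cdot\nabla)u(t)],w\rangle+a_{\mathbb T}(t;u(t),w)=\langle f(t),w\rangle\quad\text{for a.e. }t\in(0,T),\ \forall\,w\in\dot{\mathbf H}^1_\sigma,$$ and $\langle u(0),w\rangle=\langle u^0,w\rangle$ for all $w\in\dot{\mathbf H}^0_\sigma$, where $u(0)$ is the value at $0$ of the version of $u$ that is weakly continuous from $[0,T]$ to $\mathbf L_2(\mathbb T)$. A weak solution $u$ is called a Serrin-type solution if $u\in L_2(0,T;\dot{\mathbf H}^{n/2}_\sigma)$. **Theorem (Energy equality for Serrin-type solutions).** Let $u$ be a Serrin-type solution. Then $(u\cdot\nabla)u\in L_2(0,T;\mathbf H^{-1})$ and $u'\in L_2(0,T;\dot{\mathbf H}^{-1}_\sigma)$. Moreover, $u$ is almost everywhere on $(0,T)$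 equal to a function in $C^0([0,T];\dot{\mathbf H}^0_\sigma)$, again denoted by $u$; the functions $\tau\mapsto a_{\mathbb T}(\tau;u(\tau),u(\tau))$ and $\tau\mapsto\langle f(\tau),u(\tau)\rangle$ are integrable on $(0,T)$, and for every $[t_0,t]\subset[0,T]$ $$\tfrac12\|u(t)\|_{\mathbf L_2(\mathbb T)}^2+\int_{t_0}^t a_{\mathbb T}(\tau;u(\tau),u(\tau))\,d\tau=\tfrac12\|u(t_0)\|_{\mathbf L_2(\mathbb T)}^2+\int_{t_0}^t\langle f(\tau),u(\tau)\rangle\,d\tau.$$ In particular, for every $t\in[0,T]$, $$\tfrac12\|u(t)\|_{\mathbf L_2(\mathbb T)}^2+\int_{0}^t a_{\mathbb T}(\tau;u(\tau),u(\tau))\,d\tau=\tfrac12\|u^0\|_{\mathbf L_2(\mathbb T)}^2+\int_{0}^t\langle f(\tau),u(\tau)\rangle\,d\tau.$$ -/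

import Mathlib

open MeasureTheory Set Filter Topology
open scoped ENNReal ContDiff

noncomputable section

namespace PeriodicNS

/-! ### Periodic test functions and (real) distributions on the torus -/

/-- Real-valued smooth `1`-periodic functions on `ℝⁿ`, i.e. smooth functions on the torus. -/
def testFunctions (n : ℕ) : Submodule ℝ ((Fin n → ℝ) → ℝ) where
  carrier := {φ | ContDiff ℝ ∞ φ ∧
    ∀ (x : Fin n → ℝ) (ξ : Fin n → ℤ), φ (fun i => x i + (ξ i : ℝ)) = φ x}
  add_mem' := fun {φ ψ} hφ hψ =>
    ⟨hφ.1.add hψ.1, fun x ξ => by simp only [Pi.add_apply, hφ.2 x ξ, hψ.2 x ξ]⟩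
  zero_mem' := ⟨contDiff_const, fun _ _ => rfl⟩
  smul_mem' := fun c φ hφ =>
    ⟨contDiff_const.smul hφ.1, fun x ξ => by simp only [Pi.smul_apply, hφ.2 x ξ]⟩

/-- A real torus distribution: a linear functional on the real smooth periodic functions that is
continuous, i.e. bounded by finitely many of the seminorms `sup |∂^k φ|`. -/
structure TorusDistribution (n : ℕ) where
  toLinearMap : testFunctions n →ₗ[ℝ] ℝ
  bounded : ∃ (C : ℝ) (N : ℕ), ∀ (φ : testFunctions n) (M : ℝ),
    (∀ k ≤ N, ∀ x, ‖iteratedFDeriv ℝ k (φ : (Fin n → ℝ) → ℝ) x‖ ≤ M) →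
      |toLinearMap φ| ≤ C * M

/-- The phase `2π x·ξ`. -/
def phase {n : ℕ} (ξ : Fin n → ℤ) (x : Fin n → ℝ) : ℝ :=
  2 * Real.pi * ∑ i, x i * (ξ i : ℝ)

theorem phase_contDiff {n : ℕ} (ξ : Fin n → ℤ) : ContDiff ℝ ∞ (phase ξ) := by
  unfold phase
  fun_prop

theorem phase_add {n : ℕ} (ξ : Fin n → ℤ) (x : Fin n → ℝ) (η : Fin n → ℤ) :
    phase ξ (fun i => x i + (η i : ℝ)) =
      phase ξ x + ((∑ i, η i * ξ i : ℤ) : ℝ) * (2 * Real.pi) := by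
  simp only [phase, add_mul, Finset.sum_add_distrib, mul_add]
  push_cast
  ring

/-- `x ↦ cos (2π x·ξ)`. -/
def cosTest {n : ℕ} (ξ : Fin n → ℤ) : testFunctions n :=
  ⟨fun x => Real.cos (phase ξ x), Real.contDiff_cos.comp (phase_contDiff ξ), fun x η => by
    change Real.cos _ = Real.cos _
    rw [phase_add, Real.cos_add_int_mul_two_pi]⟩

/-- `x ↦ sin (2π x·ξ)`. -/
def sinTest {n : ℕ} (ξ : Fin n → ℤ) : testFunctions n :=
  ⟨fun x => Real.sin (phase ξ x), Real.contDiff_sin.comp (phase_contDiff ξ), fun x η => by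
    change Real.sin _ = Real.sin _
    rw [phase_add, Real.sin_add_int_mul_two_pi]⟩

/-- Families of Fourier coefficients, indexed by the frequency and the vector component. -/
abbrev Coeffs (n : ℕ) := (Fin n → ℤ) → Fin n → ℂ

/-- The Fourier coefficients `⟨g_k, e^{-2πi x·ξ}⟩` of a vector distribution `g`. -/
def distCoeff {n : ℕ} (g : Fin n → TorusDistribution n) : Coeffs n := fun ξ k =>
  (((g k).toLinearMap (cosTest ξ) : ℝ) : ℂ) -
    Complex.I * (((g k).toLinearMap (sinTest ξ) : ℝ) : ℂ)

/-! ### Square integrable vector fields on the torus -/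

/-- The normalised Haar (Lebesgue) measure on the torus `(ℝ/ℤ)ⁿ`. -/
abbrev torusMeasure (n : ℕ) : Measure (UnitAddTorus (Fin n)) :=
  Measure.pi fun _ => AddCircle.haarAddCircle

/-- Real vector fields in `L₂(𝕋)ⁿ`, with norm `(∫ |v|²)^{1/2}`. -/
abbrev VField (n : ℕ) := Lp (EuclideanSpace ℝ (Fin n)) 2 (torusMeasure n)

/-- Fourier coefficients of the components of a vector field. -/
def fieldCoeff {n : ℕ} (v : VField n) : Coeffs n := fun ξ k =>
  UnitAddTorus.mFourierCoeff
    (fun x => (((v : UnitAddTorus (Fin n) → EuclideanSpace ℝ (Fin n)) x k : ℝ) : ℂ)) ξ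

/-! ### Periodic Sobolev norms and spaces -/

/-- `ϱ(ξ) = 2π (1 + |ξ|²)^{1/2}`. -/
def rho {n : ℕ} (ξ : Fin n → ℤ) : ℝ := 2 * Real.pi * Real.sqrt (1 + ∑ i, (ξ i : ℝ) ^ 2)

/-- The squared `H^s` norm `∑_ξ ϱ(ξ)^{2s} |ĝ(ξ)|²`, possibly infinite. -/
def sobolevNormSq {n : ℕ} (s : ℝ) (c : Coeffs n) : ℝ≥0∞ :=
  ∑' ξ, ENNReal.ofReal (rho ξ ^ (2 * s)) * ∑ k, ‖c ξ k‖ₑ ^ 2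

/-- Zero mean value. -/
def MeanZero {n : ℕ} (c : Coeffs n) : Prop := ∀ k, c 0 k = 0

/-- Zero divergence, in terms of Fourier coefficients: `ξ · ĝ(ξ) = 0`. -/
def DivFree {n : ℕ} (c : Coeffs n) : Prop := ∀ ξ, ∑ k, (ξ k : ℂ) * c ξ k = 0

/-- Membership in the space of divergence-free, mean-zero fields in `H^s`. -/
structure MemHSigma {n : ℕ} (s : ℝ) (c : Coeffs n) : Prop where
  finite : sobolevNormSq s c < ⊤
  meanZero : MeanZero c
  divFree : DivFree c

/-- `c ∈ L₂(0,T; H^s)`. -/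
structure MemL2H {n : ℕ} (T s : ℝ) (c : ℝ → Coeffs n) : Prop where
  measurable : ∀ ξ k, AEMeasurable (fun t => c t ξ k) (volume.restrict (Ioo 0 T))
  finite : ∫⁻ t in Ioo 0 T, sobolevNormSq s (c t) < ⊤

/-- `c ∈ L₂(0,T; Ḣ^s)`: the values have zero mean. -/
structure MemL2HDot {n : ℕ} (T s : ℝ) (c : ℝ → Coeffs n) : Prop extends MemL2H T s c where
  meanZero : ∀ᵐ t ∂(volume.restrict (Ioo 0 T)), MeanZero (c t)

/-- `c ∈ L₂(0,T; Ḣ^s_σ)`: the values have zero mean and zero divergence. -/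
structure MemL2HSigma {n : ℕ} (T s : ℝ) (c : ℝ → Coeffs n) : Prop extends MemL2HDot T s c where
  divFree : ∀ᵐ t ∂(volume.restrict (Ioo 0 T)), DivFree (c t)

/-- `c ∈ L_∞(0,T; Ḣ^s_σ)`. -/
structure MemLinftyHSigma {n : ℕ} (T s : ℝ) (c : ℝ → Coeffs n) : Prop where
  measurable : ∀ ξ k, AEMeasurable (fun t => c t ξ k) (volume.restrict (Ioo 0 T))
  bounded : ∃ C : ℝ≥0∞, C < ⊤ ∧
    ∀ᵐ t ∂(volume.restrict (Ioo 0 T)), sobolevNormSq s (c t) ≤ C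
  meanZero : ∀ᵐ t ∂(volume.restrict (Ioo 0 T)), MeanZero (c t)
  divFree : ∀ᵐ t ∂(volume.restrict (Ioo 0 T)), DivFree (c t)

/-- The terms `∑_k ĝ_k(ξ) ĥ_k(-ξ)` of the dual product `⟨g, h⟩`. -/
def pairingTerm {n : ℕ} (c d : Coeffs n) (ξ : Fin n → ℤ) : ℂ := ∑ k, c ξ k * d (-ξ) k

/-- The dual product `⟨g, h⟩ = ∑_ξ ĝ(ξ) · ĥ(-ξ)` of real `g ∈ H^s`, `h ∈ H^{-s}`, in terms of
their Fourier coefficients (the sum is real because `g` and `h` are). -/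
def pairing {n : ℕ} (c d : Coeffs n) : ℝ := (∑' ξ, pairingTerm c d ξ).re

/-- The Leray projector onto mean-zero divergence-free fields, on Fourier coefficients. -/
def leray {n : ℕ} (c : Coeffs n) : Coeffs n := fun ξ k =>
  if ξ = 0 then 0
  else c ξ k - (ξ k : ℂ) * (∑ j, (ξ j : ℂ) * c ξ j) / ∑ j, (ξ j : ℂ) ^ 2

/-! ### Spatial derivatives, the viscous form and the advection term -/

/-- `g ∈ L₂(𝕋)` is the distributional derivative `∂_j v_k`: `ĝ(ξ) = 2πi ξ_j v̂_k(ξ)`. -/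
def IsPartialDeriv {n : ℕ} (v : VField n) (j k : Fin n) (g : Lp ℝ 2 (torusMeasure n)) : Prop :=
  ∀ ξ, UnitAddTorus.mFourierCoeff
      (fun x => (((g : UnitAddTorus (Fin n) → ℝ) x : ℝ) : ℂ)) ξ =
    2 * Real.pi * Complex.I * (ξ j : ℂ) * fieldCoeff v ξ k

open Classical in
/-- The distributional derivative `∂_j v_k` as an element of `L₂(𝕋)`. It exists and is unique for
`v ∈ H¹`; the value is `0` if `∂_j v_k` is not in `L₂(𝕋)`. -/
def partialDeriv {n : ℕ} (v : VField n) (j k : Fin n) : Lp ℝ 2 (torusMeasure n) :=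
  if h : ∃ g, IsPartialDeriv v j k g then h.choose else 0

/-- `E_{jβ}(v) = (∂_j v_β + ∂_β v_j) / 2`. -/
def strain {n : ℕ} (v : VField n) (j β : Fin n) (x : UnitAddTorus (Fin n)) : ℝ :=
  ((partialDeriv v j β : UnitAddTorus (Fin n) → ℝ) x +
    (partialDeriv v β j : UnitAddTorus (Fin n) → ℝ) x) / 2

/-- A viscosity tensor; `a i j α β (x, t)` is `a_{ij}^{αβ}(x, t)`. -/
abbrev Viscosity (n : ℕ) :=
  Fin n → Fin n → Fin n → Fin n → UnitAddTorus (Fin n) × ℝ → ℝ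

/-- All components of the tensor are in `L_∞(𝕋 × (0,T))`. -/
def Viscosity.Bounded {n : ℕ} (a : Viscosity n) (T : ℝ) : Prop :=
  ∀ i j α β, MemLp (a i j α β) ⊤ ((torusMeasure n).prod (volume.restrict (Ioo 0 T)))

/-- `a_𝕋(t; u, v) = ∫_𝕋 a_{ij}^{αβ}(x,t) E_{jβ}(u) E_{iα}(v) dx`. -/
def aForm {n : ℕ} (a : Viscosity n) (t : ℝ) (u v : VField n) : ℝ :=
  ∫ x, ∑ i, ∑ j, ∑ α, ∑ β, a i j α β (x, t) * strain u j β x * strain v i α x ∂(torusMeasure n)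

/-- The Fourier coefficients of `(v · ∇) v = ∑_j v_j ∂_j v`. -/
def advectionCoeff {n : ℕ} (v : VField n) : Coeffs n := fun ξ k =>
  UnitAddTorus.mFourierCoeff
    (fun x => ((∑ j, (v : UnitAddTorus (Fin n) → EuclideanSpace ℝ (Fin n)) x j *
      (partialDeriv v j k : UnitAddTorus (Fin n) → ℝ) x : ℝ) : ℂ)) ξ

/-! ### Solutions -/

/-- `u'` is the distributional time derivative of `u` on `(0,T)`: each Fourier coefficient of `u'`
is locally integrable in time and is the weak derivative of that of `u`. -/
def IsTimeDeriv {n : ℕ} (T : ℝ) (u : ℝ → VField n) (u' : ℝ → Fin n → TorusDistribution n) :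
    Prop :=
  ∀ ξ k, LocallyIntegrableOn (fun t => distCoeff (u' t) ξ k) (Ioo 0 T) ∧
    ∀ ψ : ℝ → ℝ, ContDiff ℝ ∞ ψ → HasCompactSupport ψ → tsupport ψ ⊆ Ioo 0 T →
      ∫ t in Ioo 0 T, (ψ t : ℂ) * distCoeff (u' t) ξ k =
        -∫ t in Ioo 0 T, ((deriv ψ t : ℝ) : ℂ) * fieldCoeff (u t) ξ k

/-- `v` agrees with `u` almost everywhere on `(0,T)` and is weakly continuous from `[0,T]` to
`L₂(𝕋)ⁿ`. -/
structure IsWeaklyContinuousVersion {n : ℕ} (T : ℝ) (u v : ℝ → VField n) : Prop where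
  ae_eq : ∀ᵐ t ∂(volume.restrict (Ioo 0 T)), v t = u t
  continuousOn : ∀ w : VField n, ContinuousOn (fun t => inner ℝ (v t) w) (Icc 0 T)

/-- Weak solutions of the anisotropic Navier-Stokes initial value problem. The dual product in
`equation` is that of `u' + P_σ[(u·∇)u]` with `w`; the `HasSum` says that its series converges.
In `initial` the value at time `0` is that of the weakly continuous version of `u` (unique on
`[0,T]`), the existence of which is not assumed here. -/
structure IsWeakSolution {n : ℕ} (T : ℝ) (a : Viscosity n)
    (f : ℝ → Fin n → TorusDistribution n) (u₀ : VField n) (u : ℝ → VField n) : Prop where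
  memLinfty : MemLinftyHSigma T 0 (fun t => fieldCoeff (u t))
  memL2 : MemL2HSigma T 1 (fun t => fieldCoeff (u t))
  equation : ∃ u' : ℝ → Fin n → TorusDistribution n, IsTimeDeriv T u u' ∧
    ∀ᵐ t ∂(volume.restrict (Ioo 0 T)), ∀ w : VField n, MemHSigma 1 (fieldCoeff w) →
      HasSum
        (pairingTerm (distCoeff (u' t) + leray (advectionCoeff (u t))) (fieldCoeff w))
        ((pairing (distCoeff (f t)) (fieldCoeff w) - aForm a t (u t) w : ℝ) : ℂ)
  initial : ∀ v : ℝ → VField n, IsWeaklyContinuousVersion T u v →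
    ∀ w : VField n, MemHSigma 0 (fieldCoeff w) → inner ℝ (v 0) w = inner ℝ u₀ w

/-- Serrin-type solutions: weak solutions in `L₂(0,T; Ḣ^{n/2}_σ)`. -/
structure IsSerrinSolution {n : ℕ} (T : ℝ) (a : Viscosity n)
    (f : ℝ → Fin n → TorusDistribution n) (u₀ : VField n) (u : ℝ → VField n) : Prop extends
    IsWeakSolution T a f u₀ u where
  memL2Serrin : MemL2HSigma T ((n : ℝ) / 2) (fun t => fieldCoeff (u t))

end PeriodicNS

end

/-! The Serrin condition makes the solution an admissible test field in its own equation. The whole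
argument runs on Fourier coefficients.

For divergence-free `u` the advection term is the divergence of u⊗u, so its coefficient at ξ is at
most ϱ(ξ) times the convolution of |û| with itself. The product estimate `tsum_convolution_sq_le`
bounds the ℓ₂ norm of this convolution by a constant times ‖u‖_{H⁰}‖u‖_{H^{n/2}}. The first factor
is bounded in time and the second is square integrable, so (u·∇)u lies in L₂(0,T; H⁻¹)
(`memL2H_advectionCoeff`). The equation bounds u' + P_σ[(u·∇)u] on solenoidal test fields through
`f` and the viscous form. That sum is itself solenoidal, so these tests control its full H⁻¹ norm
(`sobolevNormSq_neg_one_le_of_pairing_le`), and u' lies in L₂(0,T; H⁻¹).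

From u ∈ L₂(H¹) and u' ∈ L₂(H⁻¹) a Lions–Magenes argument, carried out mode by mode, gives a version
continuous into L₂ with ‖u(t)‖² − ‖u(s)‖² = 2∫⟨u',u⟩ (`exists_continuous_version`). Each coefficient
is absolutely continuous, and the series of the time integrals of the dual product terms converges
absolutely; this yields both a summable majorant and the exchange of sum and integral.

Testing with w = u(t) removes the advection term: its trilinear double series converges absolutely,
by the same product estimate, and is odd under an involution of the frequencies
(`trilinearTerm_swap`). Hence ⟨u',u⟩ = ⟨f,u⟩ − a(u,u), and integration in time gives the energy
equality. The strongly continuous version is also weakly continuous, so the initial condition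
identifies the norm at time 0. -/

namespace PeriodicNS

open UnitAddTorus
open scoped ComplexConjugate

/-! ### Fourier series of real square integrable functions on the torus -/

section Torus

variable {n : ℕ}

/-- Fourier coefficients of a real function on the torus. -/
noncomputable def coef (f : UnitAddTorus (Fin n) → ℝ) (ξ : Fin n → ℤ) : ℂ :=
  mFourierCoeff (fun x => ((f x : ℝ) : ℂ)) ξ

theorem mFourierCoeff_eq_integral_torusMeasure (F : UnitAddTorus (Fin n) → ℂ) (ξ : Fin n → ℤ) :
    mFourierCoeff F ξ = ∫ x, mFourier (-ξ) x * F x ∂(torusMeasure n) := rfl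

theorem mFourierCoeff_congr_ae {F G : UnitAddTorus (Fin n) → ℂ} (h : F =ᵐ[torusMeasure n] G)
    (ξ : Fin n → ℤ) : mFourierCoeff F ξ = mFourierCoeff G ξ := by
  rw [mFourierCoeff_eq_integral_torusMeasure, mFourierCoeff_eq_integral_torusMeasure]
  refine integral_congr_ae ?_
  filter_upwards [h] with x hx
  rw [hx]

theorem hasSum_conj_mFourierCoeff_mul {F G : UnitAddTorus (Fin n) → ℂ}
    (hF : MemLp F 2 (torusMeasure n)) (hG : MemLp G 2 (torusMeasure n)) :
    HasSum (fun ξ => conj (mFourierCoeff F ξ) * mFourierCoeff G ξ)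
      (∫ x, conj (F x) * G x ∂(torusMeasure n)) := by
  have h := UnitAddTorus.hasSum_prod_mFourierCoeff (hF.toLp F) (hG.toLp G)
  have e1 := mFourierCoeff_congr_ae hF.coeFn_toLp
  have e2 := mFourierCoeff_congr_ae hG.coeFn_toLp
  have e3 : (∫ x, conj (hF.toLp F x) * (hG.toLp G x) ∂(torusMeasure n)) =
      ∫ x, conj (F x) * G x ∂(torusMeasure n) := by
    refine integral_congr_ae ?_
    filter_upwards [hF.coeFn_toLp, hG.coeFn_toLp] with x h1 h2
    rw [h1, h2]
  rw [← e3]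
  refine h.congr_fun fun ξ => ?_
  rw [← e1, ← e2]

theorem memLp_ofReal {f : UnitAddTorus (Fin n) → ℝ} (hf : MemLp f 2 (torusMeasure n)) :
    MemLp (fun x => ((f x : ℝ) : ℂ)) 2 (torusMeasure n) := hf.ofReal

theorem coef_congr_ae {f g : UnitAddTorus (Fin n) → ℝ} (h : f =ᵐ[torusMeasure n] g)
    (ξ : Fin n → ℤ) : coef f ξ = coef g ξ :=
  mFourierCoeff_congr_ae (by filter_upwards [h] with x hx; rw [hx]) ξ

theorem conj_coef (f : UnitAddTorus (Fin n) → ℝ) (ξ : Fin n → ℤ) :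
    conj (coef f ξ) = coef f (-ξ) := by
  unfold coef
  rw [mFourierCoeff_eq_integral_torusMeasure, mFourierCoeff_eq_integral_torusMeasure,
    ← integral_conj]
  refine integral_congr_ae (Eventually.of_forall fun x => ?_)
  simp only [map_mul, Complex.conj_ofReal, ← mFourier_neg]

theorem hasSum_coef_mul {f g : UnitAddTorus (Fin n) → ℝ}
    (hf : MemLp f 2 (torusMeasure n)) (hg : MemLp g 2 (torusMeasure n)) :
    HasSum (fun ξ => conj (coef f ξ) * coef g ξ)
      ((∫ x, f x * g x ∂(torusMeasure n) : ℝ) : ℂ) := by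
  have h := hasSum_conj_mFourierCoeff_mul (memLp_ofReal hf) (memLp_ofReal hg)
  have e : (∫ x, conj ((f x : ℝ) : ℂ) * ((g x : ℝ) : ℂ) ∂(torusMeasure n)) =
      ((∫ x, f x * g x ∂(torusMeasure n) : ℝ) : ℂ) := by
    rw [← integral_complex_ofReal]
    refine integral_congr_ae (Eventually.of_forall fun x => ?_)
    simp only [Complex.conj_ofReal, Complex.ofReal_mul]
  rw [← e]
  exact h

theorem hasSum_norm_coef_sq {f : UnitAddTorus (Fin n) → ℝ} (hf : MemLp f 2 (torusMeasure n)) :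
    HasSum (fun ξ => ‖coef f ξ‖ ^ 2) (∫ x, f x ^ 2 ∂(torusMeasure n)) := by
  have h := hasSum_coef_mul hf hf
  rw [← Complex.hasSum_ofReal]
  convert h using 2
  · rw [Complex.conj_mul']; push_cast; rfl
  · simp only [pow_two]

theorem norm_mFourier_apply (ξ : Fin n → ℤ) (x : UnitAddTorus (Fin n)) : ‖mFourier ξ x‖ = 1 := by
  simp only [mFourier, fourier_apply, ContinuousMap.coe_mk, norm_prod, Circle.norm_coe,
    Finset.prod_const_one]

theorem memLp_mFourier_mul {F : UnitAddTorus (Fin n) → ℂ} (hF : MemLp F 2 (torusMeasure n))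
    (ξ : Fin n → ℤ) : MemLp (fun x => mFourier ξ x * F x) 2 (torusMeasure n) := by
  refine hF.of_le (((mFourier ξ).continuous.aestronglyMeasurable).mul hF.1)
    (Eventually.of_forall fun x => ?_)
  rw [norm_mul, norm_mFourier_apply, one_mul]

/-- Parseval applied to `f` and the modulated function e^{-2πi x·ξ} `g`. Since `f` is real, the
conjugate disappears after the reindexing η ↦ −η. -/
theorem hasSum_coef_convolution {f g : UnitAddTorus (Fin n) → ℝ}
    (hf : MemLp f 2 (torusMeasure n)) (hg : MemLp g 2 (torusMeasure n)) (ξ : Fin n → ℤ) :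
    HasSum (fun η => coef f η * coef g (ξ - η)) (coef (fun x => f x * g x) ξ) := by
  have h := hasSum_conj_mFourierCoeff_mul (memLp_ofReal hf)
    (memLp_mFourier_mul (memLp_ofReal hg) (-ξ))
  have e : (∫ x, conj ((f x : ℝ) : ℂ) * (mFourier (-ξ) x * (g x : ℂ)) ∂(torusMeasure n)) =
      coef (fun x => f x * g x) ξ := by
    unfold coef
    rw [mFourierCoeff_eq_integral_torusMeasure]
    refine integral_congr_ae (Eventually.of_forall fun x => ?_)
    simp only [Complex.conj_ofReal, Complex.ofReal_mul]
    ring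
  rw [e, ← (Equiv.neg (Fin n → ℤ)).hasSum_iff] at h
  refine h.congr_fun fun η => ?_
  simp only [Function.comp_apply, Equiv.neg_apply]
  congr 1
  · rw [← Complex.conj_conj (coef f η), conj_coef]; rfl
  · unfold coef
    rw [mFourierCoeff_eq_integral_torusMeasure, mFourierCoeff_eq_integral_torusMeasure]
    refine integral_congr_ae (Eventually.of_forall fun x => ?_)
    simp only [← mul_assoc, ← mFourier_add]
    congr 3
    abel

theorem coef_add {f g : UnitAddTorus (Fin n) → ℝ}
    (hf : MemLp f 2 (torusMeasure n)) (hg : MemLp g 2 (torusMeasure n)) (ξ : Fin n → ℤ) :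
    coef (fun x => f x + g x) ξ = coef f ξ + coef g ξ := by
  unfold coef
  simp only [mFourierCoeff_eq_integral_torusMeasure]
  rw [← integral_add]
  · simp only [Complex.ofReal_add, mul_add]
  · exact (memLp_mFourier_mul (memLp_ofReal hf) (-ξ)).integrable (by norm_num)
  · exact (memLp_mFourier_mul (memLp_ofReal hg) (-ξ)).integrable (by norm_num)

theorem coef_const_mul (r : ℝ) (f : UnitAddTorus (Fin n) → ℝ) (ξ : Fin n → ℤ) :
    coef (fun x => r * f x) ξ = r * coef f ξ := by
  unfold coef
  simp only [mFourierCoeff_eq_integral_torusMeasure]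
  rw [← integral_const_mul]
  refine integral_congr_ae (Eventually.of_forall fun x => ?_)
  simp only [Complex.ofReal_mul]
  ring

theorem coef_sum {ι : Type*} (s : Finset ι) (f : ι → UnitAddTorus (Fin n) → ℝ)
    (hf : ∀ i ∈ s, Integrable (f i) (torusMeasure n)) (ξ : Fin n → ℤ) :
    coef (fun x => ∑ i ∈ s, f i x) ξ = ∑ i ∈ s, coef (f i) ξ := by
  unfold coef
  simp only [mFourierCoeff_eq_integral_torusMeasure]
  rw [← integral_finsetSum]
  · simp only [Complex.ofReal_sum, Finset.mul_sum]
  · intro i hi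
    have hi' : Integrable (fun x => ((f i x : ℝ) : ℂ)) (torusMeasure n) := (hf i hi).ofReal
    refine hi'.mono (((mFourier (-ξ)).continuous.aestronglyMeasurable).mul hi'.1)
      (Eventually.of_forall fun x => ?_)
    rw [norm_mul, norm_mFourier_apply, one_mul]

/-- Riesz–Fischer gives a complex function `G`. By the symmetry `hc`, `G` and its conjugate have the
same coefficients, hence so does the real part. -/
theorem exists_coef_eq (c : (Fin n → ℤ) → ℂ) (hc : ∀ ξ, conj (c ξ) = c (-ξ))
    (hs : Summable fun ξ => ‖c ξ‖ ^ 2) :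
    ∃ f : UnitAddTorus (Fin n) → ℝ, MemLp f 2 (torusMeasure n) ∧ ∀ ξ, coef f ξ = c ξ := by
  have hm : Memℓp c 2 := by
    refine memℓp_gen ?_
    simpa using hs
  set G := mFourierBasis.repr.symm ⟨c, hm⟩ with hG
  have hGm : MemLp (fun x => G x) 2 (torusMeasure n) := Lp.memLp G
  have hGc : ∀ ξ, mFourierCoeff G ξ = c ξ := fun ξ => by
    rw [← mFourierBasis_repr, hG, LinearIsometryEquiv.apply_symm_apply]
  refine ⟨fun x => (G x).re, hGm.re, fun ξ => ?_⟩
  have h1 : mFourierCoeff (fun x => conj (G x)) ξ = c ξ := by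
    rw [← Complex.conj_conj (c ξ), hc, ← hGc, mFourierCoeff_eq_integral_torusMeasure,
      mFourierCoeff_eq_integral_torusMeasure, ← integral_conj]
    refine integral_congr_ae (Eventually.of_forall fun x => ?_)
    simp only [map_mul, ← mFourier_neg, neg_neg]
  have h2 : coef (fun x => (G x).re) ξ =
      (1 / 2 : ℂ) * (mFourierCoeff G ξ + mFourierCoeff (fun x => conj (G x)) ξ) := by
    unfold coef
    simp only [mFourierCoeff_eq_integral_torusMeasure]
    rw [← integral_add, ← integral_const_mul]
    · refine integral_congr_ae (Eventually.of_forall fun x => ?_)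
      simp only [Complex.re_eq_add_conj]
      ring
    · exact (memLp_mFourier_mul hGm (-ξ)).integrable (by norm_num)
    · exact (memLp_mFourier_mul hGm.star (-ξ)).integrable (by norm_num)
  rw [h2, h1, hGc]
  ring

/-! ### Fourier series of square integrable vector fields -/

theorem memLp_component (v : VField n) (k : Fin n) :
    MemLp (fun x => (v : UnitAddTorus (Fin n) → EuclideanSpace ℝ (Fin n)) x k) 2
      (torusMeasure n) := by
  refine (Lp.memLp v).of_le ?_ (Eventually.of_forall fun x => ?_)
  · exact (EuclideanSpace.proj k :
      EuclideanSpace ℝ (Fin n) →L[ℝ] ℝ).continuous.comp_aestronglyMeasurable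
      (Lp.memLp v).1
  · exact PiLp.norm_apply_le _ _

theorem fieldCoeff_eq_coef (v : VField n) (ξ : Fin n → ℤ) (k : Fin n) :
    fieldCoeff v ξ k =
      coef (fun x => (v : UnitAddTorus (Fin n) → EuclideanSpace ℝ (Fin n)) x k) ξ := rfl

theorem conj_fieldCoeff (v : VField n) (ξ : Fin n → ℤ) (k : Fin n) :
    conj (fieldCoeff v ξ k) = fieldCoeff v (-ξ) k := conj_coef _ _

theorem hasSum_norm_fieldCoeff_sq (v : VField n) :
    HasSum (fun ξ => ∑ k, ‖fieldCoeff v ξ k‖ ^ 2) (‖v‖ ^ 2) := by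
  have h : ‖v‖ ^ 2 = ∑ k, ∫ x, (v : UnitAddTorus (Fin n) → EuclideanSpace ℝ (Fin n)) x k ^ 2
      ∂(torusMeasure n) := by
    rw [← real_inner_self_eq_norm_sq, L2.inner_def, ← integral_finsetSum]
    · refine integral_congr_ae (Eventually.of_forall fun x => ?_)
      simp only [real_inner_self_eq_norm_sq, EuclideanSpace.norm_sq_eq, Real.norm_eq_abs, sq_abs]
    · exact fun k _ => (memLp_component v k).integrable_sq
  rw [h]
  exact hasSum_sum fun k _ => hasSum_norm_coef_sq (memLp_component v k)

theorem fieldCoeff_sub (v w : VField n) (ξ : Fin n → ℤ) (k : Fin n) :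
    fieldCoeff (v - w) ξ k = fieldCoeff v ξ k - fieldCoeff w ξ k := by
  have h : (fun x => (v - w : VField n) x k) =ᵐ[torusMeasure n]
      fun x => v x k + (-1) * w x k := by
    filter_upwards [Lp.coeFn_sub v w] with x hx
    rw [hx]; simp [sub_eq_add_neg]
  rw [fieldCoeff_eq_coef, coef_congr_ae h,
    coef_add (memLp_component v k) ((memLp_component w k).const_mul (-1)), coef_const_mul]
  simp only [fieldCoeff_eq_coef]
  push_cast; ring

theorem fieldCoeff_injective {v w : VField n} (h : ∀ ξ k, fieldCoeff v ξ k = fieldCoeff w ξ k) :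
    v = w := by
  have h1 := hasSum_norm_fieldCoeff_sq (v - w)
  simp only [fieldCoeff_sub, h, sub_self, norm_zero, ne_eq, OfNat.ofNat_ne_zero,
    not_false_eq_true, zero_pow, Finset.sum_const_zero] at h1
  have := pow_eq_zero_iff (two_ne_zero) |>.1 (h1.unique hasSum_zero)
  exact sub_eq_zero.1 (norm_eq_zero.1 this)

theorem exists_fieldCoeff_eq (c : Coeffs n) (hc : ∀ ξ k, conj (c ξ k) = c (-ξ) k)
    (hs : Summable fun ξ => ∑ k, ‖c ξ k‖ ^ 2) : ∃ v : VField n, fieldCoeff v = c := by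
  have hk : ∀ k, Summable fun ξ => ‖c ξ k‖ ^ 2 := fun k =>
    hs.of_nonneg_of_le (fun _ => sq_nonneg _) fun ξ =>
      Finset.single_le_sum (f := fun k => ‖c ξ k‖ ^ 2) (fun _ _ => sq_nonneg _) (Finset.mem_univ k)
  choose f hf hfc using fun k => exists_coef_eq (fun ξ => c ξ k) (fun ξ => hc ξ k) (hk k)
  have hm : MemLp (fun x => (WithLp.toLp 2 (fun k => f k x) : EuclideanSpace ℝ (Fin n))) 2
      (torusMeasure n) := MemLp.of_eval_piLp hf
  refine ⟨hm.toLp _, ?_⟩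
  ext ξ k
  rw [← hfc, fieldCoeff_eq_coef]
  refine coef_congr_ae ?_ ξ
  filter_upwards [hm.coeFn_toLp] with x hx
  rw [hx]

end Torus

/-! ### The Cauchy–Schwarz inequality for extended nonnegative integrals and sums -/

theorem lintegral_mul_sq_le {α : Type*} [MeasurableSpace α] {μ : Measure α} {f g : α → ℝ≥0∞}
    (hf : AEMeasurable f μ) (hg : AEMeasurable g μ) :
    (∫⁻ x, f x * g x ∂μ) ^ 2 ≤ (∫⁻ x, f x ^ 2 ∂μ) * ∫⁻ x, g x ^ 2 ∂μ := by
  have h := ENNReal.lintegral_mul_le_Lp_mul_Lq μ Real.HolderConjugate.two_two hf hg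
  have h2 := pow_le_pow_left₀ (zero_le) h 2
  refine (le_of_eq ?_).trans (h2.trans (le_of_eq ?_))
  · rfl
  · rw [mul_pow, ← ENNReal.rpow_natCast, ← ENNReal.rpow_natCast, ← ENNReal.rpow_mul,
      ← ENNReal.rpow_mul]
    norm_num

theorem tsum_mul_sq_le {ι : Type*} (f g : ι → ℝ≥0∞) :
    (∑' i, f i * g i) ^ 2 ≤ (∑' i, f i ^ 2) * ∑' i, g i ^ 2 := by
  let _ : MeasurableSpace ι := ⊤
  have h := lintegral_mul_sq_le (μ := Measure.count) (f := f) (g := g)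
    (measurable_from_top).aemeasurable (measurable_from_top).aemeasurable
  rwa [lintegral_count' measurable_from_top, lintegral_count' measurable_from_top,
    lintegral_count' measurable_from_top] at h

/-! ### The weight `ϱ` -/

variable {n : ℕ}

theorem one_add_abs_le_rho (ξ : Fin n → ℤ) (i : Fin n) : 1 + |(ξ i : ℝ)| ≤ rho ξ := by
  have h1 : |(ξ i : ℝ)| ^ 2 ≤ ∑ i, (ξ i : ℝ) ^ 2 := by
    rw [sq_abs]
    exact Finset.single_le_sum (f := fun i => (ξ i : ℝ) ^ 2) (fun _ _ => sq_nonneg _)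
      (Finset.mem_univ i)
  have h2 : (1 + |(ξ i : ℝ)|) / 2 ≤ Real.sqrt (1 + ∑ i, (ξ i : ℝ) ^ 2) := by
    refine Real.le_sqrt_of_sq_le ?_
    nlinarith [sq_nonneg (1 - |(ξ i : ℝ)|)]
  have h3 := Real.pi_gt_three
  have h4 := Real.sqrt_nonneg (1 + ∑ i, (ξ i : ℝ) ^ 2)
  unfold rho
  nlinarith

theorem one_le_rho (ξ : Fin n → ℤ) : 1 ≤ rho ξ := by
  have h2 : (1 : ℝ) ≤ Real.sqrt (1 + ∑ i, (ξ i : ℝ) ^ 2) :=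
    Real.le_sqrt_of_sq_le (by
      have : 0 ≤ ∑ i, (ξ i : ℝ) ^ 2 := Finset.sum_nonneg fun _ _ => sq_nonneg _
      linarith)
  have h3 := Real.pi_gt_three
  unfold rho
  nlinarith

theorem rho_pos (ξ : Fin n → ℤ) : 0 < rho ξ := zero_lt_one.trans_le (one_le_rho ξ)

theorem rho_neg (ξ : Fin n → ℤ) : rho (-ξ) = rho ξ := by simp [rho]

theorem two_pi_abs_le_rho (ξ : Fin n → ℤ) (i : Fin n) : 2 * Real.pi * |(ξ i : ℝ)| ≤ rho ξ := by
  have h1 : |(ξ i : ℝ)| ^ 2 ≤ ∑ i, (ξ i : ℝ) ^ 2 := by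
    rw [sq_abs]
    exact Finset.single_le_sum (f := fun i => (ξ i : ℝ) ^ 2) (fun _ _ => sq_nonneg _)
      (Finset.mem_univ i)
  unfold rho
  have : |(ξ i : ℝ)| ≤ Real.sqrt (1 + ∑ i, (ξ i : ℝ) ^ 2) := Real.le_sqrt_of_sq_le (by linarith)
  gcongr

theorem sum_inv_sqrt_le (R : ℕ) :
    ∑ m ∈ Finset.Icc (-(R : ℤ)) R, 1 / Real.sqrt (1 + |(m : ℝ)|) ≤ 4 * Real.sqrt (R + 1) := by
  induction R with
  | zero => norm_num
  | succ R ih =>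
    have e : Finset.Icc (-((R + 1 : ℕ) : ℤ)) ((R + 1 : ℕ) : ℤ) =
        insert (-((R + 1 : ℕ) : ℤ)) (insert ((R + 1 : ℕ) : ℤ) (Finset.Icc (-(R : ℤ)) R)) := by
      ext m; simp only [Finset.mem_Icc, Finset.mem_insert]; omega
    have hR : (0 : ℝ) ≤ R := Nat.cast_nonneg R
    have habs : |((-(R + 1 : ℕ) : ℤ) : ℝ)| = R + 1 := by
      push_cast; rw [abs_of_nonpos] <;> linarith
    have habs' : |(((R + 1 : ℕ) : ℤ) : ℝ)| = R + 1 := by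
      push_cast; rw [abs_of_nonneg]; linarith
    rw [e, Finset.sum_insert (by simp only [Finset.mem_Icc, Finset.mem_insert]; omega),
      Finset.sum_insert (by simp only [Finset.mem_Icc]; omega), habs, habs']
    set x := Real.sqrt (1 + ((R : ℝ) + 1)) with hx
    set y := Real.sqrt ((R : ℝ) + 1) with hy
    have hx2 : x ^ 2 = 1 + ((R : ℝ) + 1) := Real.sq_sqrt (by linarith)
    have hy2 : y ^ 2 = (R : ℝ) + 1 := Real.sq_sqrt (by linarith)
    have hy0 : 0 ≤ y := Real.sqrt_nonneg _
    have hx0 : 0 < x := Real.sqrt_pos.2 (by linarith)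
    have hgoal : Real.sqrt (((R + 1 : ℕ) : ℝ) + 1) = x := by rw [hx]; congr 1; push_cast; ring
    rw [hgoal]
    -- The two new terms ±(R+1) contribute 2/x, to be absorbed by the increment 4(x − y). This
    -- follows from x² − y² = 1 and 2xy ≤ x² + y².
    have key : 1 / x ≤ 2 * x - 2 * y := by
      rw [div_le_iff₀ hx0]
      nlinarith [sq_nonneg (x - y)]
    linarith

/-- Distributing ϱ^{-n/2} as one factor ϱ^{-1/2} per coordinate makes lattice sums over cubes
factorise into one-dimensional sums. -/
theorem rho_rpow_le_prod (ξ : Fin n → ℤ) :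
    rho ξ ^ (-((n : ℝ) / 2)) ≤ ∏ i, 1 / Real.sqrt (1 + |(ξ i : ℝ)|) := by
  have h : rho ξ ^ (-((n : ℝ) / 2)) = ∏ _i : Fin n, 1 / Real.sqrt (rho ξ) := by
    rw [Finset.prod_const, Finset.card_univ, Fintype.card_fin, Real.sqrt_eq_rpow, one_div,
      ← Real.rpow_neg (rho_pos ξ).le, ← Real.rpow_natCast, ← Real.rpow_mul (rho_pos ξ).le]
    congr 1; ring
  rw [h]
  refine Finset.prod_le_prod (fun _ _ => by positivity) fun i _ => ?_
  have := one_add_abs_le_rho ξ i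
  gcongr

/-- The ball ϱ ≤ r lies in a cube of half-side ⌊r⌋. After factorisation each of the n
one-dimensional sums is at most 4√(⌊r⌋+1) ≤ 8√r, where r ≥ 1 is used. -/
theorem tsum_rho_rpow_le (r : ℝ) (hr : 1 ≤ r) :
    ∑' ξ : Fin n → ℤ, (if rho ξ ≤ r then ENNReal.ofReal (rho ξ ^ (-((n : ℝ) / 2))) else 0) ≤
      ENNReal.ofReal (8 ^ n * r ^ ((n : ℝ) / 2)) := by
  set R := ⌊r⌋₊
  set S : Finset (Fin n → ℤ) := Fintype.piFinset fun _ => Finset.Icc (-(R : ℤ)) R with hS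
  have hmem : ∀ ξ : Fin n → ℤ, ξ ∉ S → ¬ rho ξ ≤ r := by
    intro ξ hξ hle
    refine hξ (Fintype.mem_piFinset.2 fun i => ?_)
    have h1 := (one_add_abs_le_rho ξ i).trans hle
    have h2 : (((ξ i).natAbs : ℕ) : ℝ) ≤ r := by
      rw [Nat.cast_natAbs]; push_cast; linarith
    have h3 : (ξ i).natAbs ≤ R := Nat.le_floor h2
    rw [Finset.mem_Icc]; omega
  rw [tsum_eq_sum (s := S) (fun ξ hξ => if_neg (hmem ξ hξ))]
  have h1 : ∑ ξ ∈ S, (if rho ξ ≤ r then ENNReal.ofReal (rho ξ ^ (-((n : ℝ) / 2))) else 0) ≤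
      ∑ ξ ∈ S, ENNReal.ofReal (∏ i, 1 / Real.sqrt (1 + |(ξ i : ℝ)|)) := by
    refine Finset.sum_le_sum fun ξ _ => ?_
    split_ifs
    · exact ENNReal.ofReal_le_ofReal (rho_rpow_le_prod ξ)
    · exact zero_le
  refine h1.trans ?_
  rw [← ENNReal.ofReal_sum_of_nonneg (fun ξ _ => Finset.prod_nonneg fun i _ => by positivity)]
  refine ENNReal.ofReal_le_ofReal ?_
  rw [hS, ← Finset.prod_univ_sum (fun _ => Finset.Icc (-(R : ℤ)) R)
    (fun _ m => 1 / Real.sqrt (1 + |(m : ℝ)|)), Finset.prod_const, Finset.card_univ,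
    Fintype.card_fin]
  have h2 : Real.sqrt ((R : ℝ) + 1) ≤ 2 * Real.sqrt r := by
    rw [Real.sqrt_le_left (by positivity), mul_pow, Real.sq_sqrt (by linarith)]
    have := Nat.floor_le (by linarith : (0 : ℝ) ≤ r)
    change (R : ℝ) + 1 ≤ _
    linarith
  have h3 : (r ^ ((n : ℝ) / 2)) = Real.sqrt r ^ n := by
    rw [Real.sqrt_eq_rpow, ← Real.rpow_natCast, ← Real.rpow_mul (by linarith)]
    congr 1; ring
  rw [h3, ← mul_pow]
  refine pow_le_pow_left₀ (Finset.sum_nonneg fun _ _ => by positivity) ?_ n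
  exact (sum_inv_sqrt_le R).trans (by linarith)

/-! ### The product estimate -/

theorem ofReal_rho_rpow_mul (ξ : Fin n → ℤ) (s t : ℝ) :
    ENNReal.ofReal (rho ξ ^ s) * ENNReal.ofReal (rho ξ ^ t) =
      ENNReal.ofReal (rho ξ ^ (s + t)) := by
  rw [← ENNReal.ofReal_mul (Real.rpow_nonneg (rho_pos ξ).le _), Real.rpow_add (rho_pos ξ)]

/-- A Fourier-side form of H^{n/4}·H^{n/4} ⊂ L₂, followed by interpolation of H^{n/4} between H⁰ and
H^{n/2}. By symmetry only the pairs whose first frequency is the lower one matter. There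
Cauchy–Schwarz with weights ϱ^{±n/4} leaves a sum of ϱ^{-n/2} over a ball, which `tsum_rho_rpow_le`
bounds. -/
theorem tsum_convolution_sq_le (a : (Fin n → ℤ) → ℝ≥0∞) :
    ∑' ξ, (∑' η, a η * a (ξ - η)) ^ 2 ≤
      ENNReal.ofReal (4 * 8 ^ n) * ((∑' ξ, a ξ ^ 2) *
        ∑' ξ, ENNReal.ofReal (rho ξ ^ (2 * ((n : ℝ) / 2))) * a ξ ^ 2) := by
  set p : (Fin n → ℤ) → ℝ≥0∞ := fun ξ => ENNReal.ofReal (rho ξ ^ ((n : ℝ) / 4)) with hp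
  set q : (Fin n → ℤ) → ℝ≥0∞ := fun ξ => ENNReal.ofReal (rho ξ ^ (-((n : ℝ) / 4))) with hq
  have hpq : ∀ ξ, p ξ * q ξ = 1 := fun ξ => by
    rw [hp, hq, ofReal_rho_rpow_mul]; simp
  have hq2 : ∀ ξ, q ξ ^ 2 = ENNReal.ofReal (rho ξ ^ (-((n : ℝ) / 2))) := fun ξ => by
    rw [hq, pow_two, ofReal_rho_rpow_mul]; congr 2; ring
  have hp2 : ∀ ξ, p ξ ^ 2 = ENNReal.ofReal (rho ξ ^ ((n : ℝ) / 2)) := fun ξ => by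
    rw [hp, pow_two, ofReal_rho_rpow_mul]; congr 2; ring
  -- The cutoff keeps the pairs in which η is the lower frequency. The reflection η ↦ ξ − η
  -- exchanges the two cases, whence the factor 2 in `hsym`.
  set χ : (Fin n → ℤ) → (Fin n → ℤ) → ℝ≥0∞ := fun η ζ => if rho η ≤ rho ζ then 1 else 0 with hχ
  have hχ2 : ∀ η ζ, χ η ζ ^ 2 = χ η ζ := fun η ζ => by simp only [hχ]; split_ifs <;> simp
  have hχ1 : ∀ η ζ, 1 ≤ χ η ζ + χ ζ η := fun η ζ => by
    simp only [hχ]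
    rcases le_total (rho η) (rho ζ) with h | h
    · rw [if_pos h]; exact le_self_add
    · rw [if_pos h]; exact le_add_self
  set A := ∑' ξ, (a ξ * p ξ) ^ 2 with hA
  have hsym : ∀ ξ, ∑' η, a η * a (ξ - η) ≤ 2 * ∑' η, (a η * p η) * (χ η (ξ - η) * q η * a (ξ - η)) := by
    intro ξ
    have e1 : ∑' η, (a η * p η) * (χ η (ξ - η) * q η * a (ξ - η)) =
        ∑' η, χ η (ξ - η) * (a η * a (ξ - η)) := by
      refine tsum_congr fun η => ?_
      calc _ = (p η * q η) * (χ η (ξ - η) * (a η * a (ξ - η))) := by ring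
        _ = _ := by rw [hpq, one_mul]
    have e2 : ∑' η, χ (ξ - η) η * (a η * a (ξ - η)) =
        ∑' η, χ η (ξ - η) * (a η * a (ξ - η)) := by
      rw [← (Equiv.subLeft ξ).tsum_eq]
      refine tsum_congr fun η => ?_
      simp only [Equiv.subLeft_apply, sub_sub_cancel]
      ring
    rw [e1, two_mul]
    nth_rewrite 2 [← e2]
    rw [← ENNReal.tsum_add]
    refine ENNReal.tsum_le_tsum fun η => ?_
    rw [← add_mul]
    exact le_mul_of_one_le_left zero_le (hχ1 _ _)
  have hcs : ∀ ξ, (∑' η, a η * a (ξ - η)) ^ 2 ≤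
      4 * (A * ∑' η, (χ η (ξ - η) * q η * a (ξ - η)) ^ 2) := by
    intro ξ
    refine (pow_le_pow_left₀ zero_le (hsym ξ) 2).trans ?_
    rw [mul_pow]
    have : (2 : ℝ≥0∞) ^ 2 = 4 := by norm_num
    rw [this]
    exact mul_le_mul_right (tsum_mul_sq_le _ _) _
  -- Summing over ξ first and writing ζ = ξ − η turns the inner sum into one over ϱ(η) ≤ ϱ(ζ). It
  -- costs ϱ(ζ)^{n/2}, exactly the weight in `A`.
  have hsum : ∑' ξ, ∑' η, (χ η (ξ - η) * q η * a (ξ - η)) ^ 2 ≤ ENNReal.ofReal (8 ^ n) * A := by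
    rw [ENNReal.tsum_comm]
    have e1 : ∀ η, ∑' ξ, (χ η (ξ - η) * q η * a (ξ - η)) ^ 2 = ∑' ζ, (χ η ζ * q η * a ζ) ^ 2 :=
      fun η => (Equiv.subRight η).tsum_eq (fun ζ => (χ η ζ * q η * a ζ) ^ 2)
    simp_rw [e1]
    rw [ENNReal.tsum_comm, hA, ← ENNReal.tsum_mul_left]
    refine ENNReal.tsum_le_tsum fun ζ => ?_
    have e2 : ∑' η, (χ η ζ * q η * a ζ) ^ 2 = (∑' η, χ η ζ * q η ^ 2) * a ζ ^ 2 := by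
      rw [← ENNReal.tsum_mul_right]
      refine tsum_congr fun η => ?_
      rw [mul_pow, mul_pow, hχ2]
    have e3 : ∑' η, χ η ζ * q η ^ 2 ≤ ENNReal.ofReal (8 ^ n) * p ζ ^ 2 := by
      have := tsum_rho_rpow_le (n := n) (rho ζ) (one_le_rho ζ)
      rw [ENNReal.ofReal_mul (by positivity), ← hp2] at this
      refine le_trans (le_of_eq (tsum_congr fun η => ?_)) this
      simp only [hχ, hq2, ite_mul, one_mul, zero_mul]
    rw [e2]
    calc _ ≤ ENNReal.ofReal (8 ^ n) * p ζ ^ 2 * a ζ ^ 2 := mul_le_mul_left e3 _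
      _ = _ := by ring
  -- Interpolation: `A` is the sum of a · (ϱ^{n/2} a), so Cauchy–Schwarz applies.
  have hA2 : A * A ≤ (∑' ξ, a ξ ^ 2) *
      ∑' ξ, ENNReal.ofReal (rho ξ ^ (2 * ((n : ℝ) / 2))) * a ξ ^ 2 := by
    have := tsum_mul_sq_le a (fun ξ => p ξ ^ 2 * a ξ)
    refine (le_of_eq ?_).trans (this.trans (le_of_eq ?_))
    · rw [← pow_two, hA]
      congr 1
      exact tsum_congr fun ξ => by ring
    · congr 1
      refine tsum_congr fun ξ => ?_
      rw [mul_pow, hp2, pow_two (ENNReal.ofReal _), ofReal_rho_rpow_mul, ← two_mul]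
  calc ∑' ξ, (∑' η, a η * a (ξ - η)) ^ 2
      ≤ ∑' ξ, 4 * (A * ∑' η, (χ η (ξ - η) * q η * a (ξ - η)) ^ 2) := ENNReal.tsum_le_tsum hcs
    _ = 4 * (A * ∑' ξ, ∑' η, (χ η (ξ - η) * q η * a (ξ - η)) ^ 2) := by
        rw [ENNReal.tsum_mul_left, ENNReal.tsum_mul_left]
    _ ≤ 4 * (A * (ENNReal.ofReal (8 ^ n) * A)) := by gcongr
    _ = ENNReal.ofReal (4 * 8 ^ n) * (A * A) := by
        rw [ENNReal.ofReal_mul (by norm_num), show ENNReal.ofReal 4 = 4 by simp]; ring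
    _ ≤ _ := by gcongr

/-! ### Weak derivatives on an interval -/

section WeakDerivative

/-- `d` is the weak derivative of `c` on `(0,T)`. -/
def HasWeakDeriv {E : Type*} [NormedAddCommGroup E] [NormedSpace ℝ E] (T : ℝ) (c d : ℝ → E) :
    Prop :=
  LocallyIntegrableOn d (Ioo 0 T) ∧
    ∀ ψ : ℝ → ℝ, ContDiff ℝ ∞ ψ → HasCompactSupport ψ → tsupport ψ ⊆ Ioo 0 T →
      ∫ t in Ioo 0 T, ψ t • d t = -∫ t in Ioo 0 T, deriv ψ t • c t

variable {E : Type*} [NormedAddCommGroup E] [NormedSpace ℝ E] {T : ℝ}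

theorem integrableOn_smul_of_tsupport_subset {U : Set ℝ} (hU : MeasurableSet U) {d : ℝ → E}
    (hd : LocallyIntegrableOn d U) {ψ : ℝ → ℝ} (hψ : Continuous ψ) (hc : HasCompactSupport ψ)
    (hs : tsupport ψ ⊆ U) : IntegrableOn (fun t => ψ t • d t) U := by
  have h1 : IntegrableOn d (tsupport ψ) :=
    (hd.mono_set hs).integrableOn_isCompact hc
  have h2 : IntegrableOn (fun t => ψ t • d t) (tsupport ψ) :=
    h1.continuousOn_smul hψ.continuousOn hc
  refine h2.of_forall_sdiff_eq_zero hU fun t ht => ?_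
  rw [image_eq_zero_of_notMem_tsupport ht.2, zero_smul]

theorem setIntegral_smul_eq_integral {U : Set ℝ} {d : ℝ → E} {ψ : ℝ → ℝ}
    (hs : tsupport ψ ⊆ U) : ∫ t in U, ψ t • d t = ∫ t, ψ t • d t :=
  setIntegral_eq_integral_of_forall_compl_eq_zero fun t ht => by
    rw [image_eq_zero_of_notMem_tsupport fun h => ht (hs h), zero_smul]

theorem integrableOn_deriv_smul {c : ℝ → E} (hc : IntegrableOn c (Ioo 0 T)) {ψ : ℝ → ℝ}
    (hψ : ContDiff ℝ ∞ ψ) (hcs : HasCompactSupport ψ) (hs : tsupport ψ ⊆ Ioo 0 T) :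
    IntegrableOn (fun t => deriv ψ t • c t) (Ioo 0 T) :=
  integrableOn_smul_of_tsupport_subset measurableSet_Ioo hc.locallyIntegrableOn
    (hψ.continuous_deriv (by simp)) hcs.deriv ((tsupport_deriv_subset (𝕜 := ℝ)).trans hs)

theorem HasWeakDeriv.congr_ae {c c' d : ℝ → E} (h : HasWeakDeriv T c d)
    (hc : c =ᵐ[volume.restrict (Ioo 0 T)] c') : HasWeakDeriv T c' d := by
  refine ⟨h.1, fun ψ h1 h2 h3 => ?_⟩
  rw [h.2 ψ h1 h2 h3]
  congr 1
  refine integral_congr_ae ?_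
  filter_upwards [hc] with t ht
  rw [ht]

theorem HasWeakDeriv.unique [CompleteSpace E] {c d d' : ℝ → E} (h : HasWeakDeriv T c d)
    (h' : HasWeakDeriv T c d') : d =ᵐ[volume.restrict (Ioo 0 T)] d' := by
  have key := isOpen_Ioo.ae_eq_zero_of_integral_contDiff_smul_eq_zero (h.1.sub h'.1)
    (fun ψ h1 h2 h3 => by
      rw [← setIntegral_smul_eq_integral h3]
      simp only [Pi.sub_apply, smul_sub]
      rw [integral_sub
        (integrableOn_smul_of_tsupport_subset measurableSet_Ioo h.1 h1.continuous h2 h3)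
        (integrableOn_smul_of_tsupport_subset measurableSet_Ioo h'.1 h1.continuous h2 h3),
        h.2 ψ h1 h2 h3, h'.2 ψ h1 h2 h3, sub_self])
  filter_upwards [(ae_restrict_iff' measurableSet_Ioo).2 key] with t ht
  exact sub_eq_zero.1 ht

theorem HasWeakDeriv.zero : HasWeakDeriv T (0 : ℝ → E) 0 :=
  ⟨(locallyIntegrable_zero).locallyIntegrableOn _, fun ψ _ _ _ => by simp⟩

theorem HasWeakDeriv.sum_const_mul {ι : Type*} (s : Finset ι) (α : ι → ℂ) {c d : ι → ℝ → ℂ}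
    (hc : ∀ i ∈ s, IntegrableOn (c i) (Ioo 0 T)) (h : ∀ i ∈ s, HasWeakDeriv T (c i) (d i)) :
    HasWeakDeriv T (fun t => ∑ i ∈ s, α i * c i t) (fun t => ∑ i ∈ s, α i * d i t) := by
  constructor
  · have : (fun t => ∑ i ∈ s, α i * d i t) = ∑ i ∈ s, α i • d i := by
      ext t; simp [Finset.sum_apply]
    rw [this]
    clear hc this
    induction s using Finset.cons_induction with
    | empty => rw [Finset.sum_empty]; exact (HasWeakDeriv.zero (E := ℂ)).1
    | cons a s ha ih =>
      rw [Finset.sum_cons]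
      exact ((h a (Finset.mem_cons_self a s)).1.smul _).add
        (ih fun i hi => h i (Finset.mem_cons_of_mem hi))
  · intro ψ h1 h2 h3
    simp only [Finset.smul_sum, mul_comm (α _), ← smul_mul_assoc]
    rw [integral_finsetSum, integral_finsetSum, ← Finset.sum_neg_distrib]
    · refine Finset.sum_congr rfl fun i hi => ?_
      rw [integral_mul_const, integral_mul_const, (h i hi).2 ψ h1 h2 h3, neg_mul]
    · exact fun i hi => (integrableOn_deriv_smul (hc i hi) h1 h2 h3).mul_const _
    · exact fun i hi => (integrableOn_smul_of_tsupport_subset measurableSet_Ioo (h i hi).1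
        h1.continuous h2 h3).mul_const _

/-- The primitive from 0 vanishes to the left of the support of `g` trivially, and to the right of
it because the total integral is zero. -/
theorem exists_primitive_of_integral_eq_zero {g : ℝ → ℝ} (hg : ContDiff ℝ ∞ g)
    (hc : HasCompactSupport g) (hs : tsupport g ⊆ Ioo 0 T) (h0 : ∫ t, g t = 0) :
    ∃ ψ : ℝ → ℝ, ContDiff ℝ ∞ ψ ∧ HasCompactSupport ψ ∧ tsupport ψ ⊆ Ioo 0 T ∧ deriv ψ = g := by
  rcases (tsupport g).eq_empty_or_nonempty with he | hne
  · have : g = 0 := tsupport_eq_empty_iff.1 he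
    subst this
    exact ⟨0, contDiff_const, HasCompactSupport.zero, by simp [tsupport], by ext; simp⟩
  obtain ⟨a, ha⟩ := hc.exists_isLeast hne
  obtain ⟨b, hb⟩ := hc.exists_isGreatest hne
  have ha0 := (hs ha.1).1
  have hbT := (hs hb.1).2
  have hsub : Function.support g ⊆ Icc a b := fun t ht =>
    ⟨ha.2 (subset_tsupport _ ht), hb.2 (subset_tsupport _ ht)⟩
  have hzero : ∀ t, t ∉ Icc a b → g t = 0 := fun t ht => by
    by_contra h; exact ht (hsub h)
  have hder : ∀ t, HasDerivAt (fun t => ∫ x in (0 : ℝ)..t, g x) (g t) t := fun t =>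
    intervalIntegral.integral_hasDerivAt_right (hg.continuous.intervalIntegrable _ _)
      hg.continuous.stronglyMeasurable.stronglyMeasurableAtFilter hg.continuous.continuousAt
  have hderiv : deriv (fun t => ∫ x in (0 : ℝ)..t, g x) = g := funext fun t => (hder t).deriv
  have hsupp : Function.support (fun t => ∫ x in (0 : ℝ)..t, g x) ⊆ Icc a b := by
    intro t ht
    by_contra hn
    refine ht ?_
    rw [mem_Icc, not_and_or, not_le, not_le] at hn
    rcases hn with h | h
    · refine intervalIntegral.integral_zero_ae (Eventually.of_forall fun x hx => hzero x fun hx' => ?_)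
      have := hx.2.trans (sup_le ha0.le h.le)
      rcases this.lt_or_eq with h1 | h1
      · exact absurd hx'.1 (not_le.2 h1)
      · have h2 : x ≤ max 0 t := hx.2
        have h3 := max_lt ha0 h
        exact absurd h1 (h2.trans_lt h3).ne
    · change ∫ x in (0 : ℝ)..t, g x = 0
      rw [intervalIntegral.integral_eq_integral_of_support_subset, h0]
      exact fun x hx => ⟨ha0.trans_le (hsub hx).1, (hsub hx).2.trans h.le⟩
  have hts : tsupport (fun t => ∫ x in (0 : ℝ)..t, g x) ⊆ Icc a b :=
    closure_minimal hsupp isClosed_Icc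
  refine ⟨_, ?_, ?_, hts.trans fun t ht => ⟨ha0.trans_le ht.1, ht.2.trans_lt hbT⟩, hderiv⟩
  · rw [contDiff_infty_iff_deriv, hderiv]
    exact ⟨fun t => (hder t).differentiableAt, hg⟩
  · exact isCompact_Icc.of_isClosed_subset (isClosed_tsupport _) hts

/-- The du Bois-Reymond lemma. Subtracting from a test function its integral times a fixed bump of
integral one leaves the derivative of an admissible test function. The constant is therefore the
average of `h` against that bump. -/
theorem ae_eq_const_of_integral_deriv_smul_eq_zero (hT : 0 < T) {h : ℝ → ℝ}
    (hh : IntegrableOn h (Ioo 0 T))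
    (hz : ∀ ψ : ℝ → ℝ, ContDiff ℝ ∞ ψ → HasCompactSupport ψ → tsupport ψ ⊆ Ioo 0 T →
      ∫ t in Ioo 0 T, deriv ψ t • h t = 0) :
    ∃ K : ℝ, ∀ᵐ t ∂(volume.restrict (Ioo 0 T)), h t = K := by
  let B : ContDiffBump (T / 2) := ⟨T / 8, T / 4, by positivity, by linarith⟩
  set φ₀ := B.normed volume with hφ₀
  have h01 : ContDiff ℝ ∞ φ₀ := B.contDiff_normed
  have h02 : HasCompactSupport φ₀ := B.hasCompactSupport_normed
  have h03 : tsupport φ₀ ⊆ Ioo 0 T := by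
    rw [hφ₀, B.tsupport_normed_eq, Real.closedBall_eq_Icc]
    intro t ht
    have h1 : T / 2 - T / 4 ≤ t := ht.1
    have h2 : t ≤ T / 2 + T / 4 := ht.2
    constructor <;> linarith
  have h04 : ∫ t, φ₀ t = 1 := B.integral_normed
  refine ⟨∫ t in Ioo 0 T, φ₀ t • h t, ?_⟩
  set K := ∫ t in Ioo 0 T, φ₀ t • h t with hK
  have hint : ∀ φ : ℝ → ℝ, Continuous φ → HasCompactSupport φ → tsupport φ ⊆ Ioo 0 T →
      IntegrableOn (fun t => φ t • h t) (Ioo 0 T) := fun φ a b c =>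
    integrableOn_smul_of_tsupport_subset measurableSet_Ioo hh.locallyIntegrableOn a b c
  have hKi : IntegrableOn (fun _ : ℝ => K) (Ioo 0 T) := by simp
  have key := isOpen_Ioo.ae_eq_zero_of_integral_contDiff_smul_eq_zero
    (hh.sub hKi).locallyIntegrableOn (fun φ h1 h2 h3 => by
      rw [← setIntegral_smul_eq_integral h3]
      set m := ∫ t, φ t with hm
      have hi : Integrable φ := h1.continuous.integrable_of_hasCompactSupport h2
      have hi0 : Integrable φ₀ := h01.continuous.integrable_of_hasCompactSupport h02
      have hts : tsupport (fun t => φ t - m * φ₀ t) ⊆ tsupport φ ∪ tsupport φ₀ := by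
        refine closure_minimal (fun t ht => ?_) ((isClosed_tsupport _).union (isClosed_tsupport _))
        by_contra hn
        rw [mem_union, not_or] at hn
        exact ht (by simp only [image_eq_zero_of_notMem_tsupport hn.1,
          image_eq_zero_of_notMem_tsupport hn.2, mul_zero, sub_zero])
      obtain ⟨ψ, g1, g2, g3, g4⟩ := exists_primitive_of_integral_eq_zero (T := T)
        (g := fun t => φ t - m * φ₀ t) (h1.sub (contDiff_const.mul h01))
        ((h2.isCompact.union h02.isCompact).of_isClosed_subset (isClosed_tsupport _) hts)
        (hts.trans (union_subset h3 h03)) (by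
          rw [integral_sub hi (hi0.const_mul m), integral_const_mul, h04, mul_one, sub_self])
      have g5 := hz ψ g1 g2 g3
      rw [g4] at g5
      have e1 : ∫ t in Ioo 0 T, (φ t - m * φ₀ t) • h t = (∫ t in Ioo 0 T, φ t • h t) - m * K := by
        rw [hK, ← integral_const_mul, ← integral_sub (hint φ h1.continuous h2 h3)
          ((hint φ₀ h01.continuous h02 h03).const_mul m)]
        congr 1; ext t; simp only [smul_eq_mul]; ring
      have e2 : ∫ t in Ioo 0 T, φ t • (h t - K) = (∫ t in Ioo 0 T, φ t • h t) - m * K := by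
        have e3 : ∫ t in Ioo 0 T, φ t • K = m * K := by
          rw [setIntegral_smul_eq_integral h3]
          simp only [smul_eq_mul]
          rw [integral_mul_const]
        rw [← e3, ← integral_sub (hint φ h1.continuous h2 h3)
          (integrableOn_smul_of_tsupport_subset measurableSet_Ioo hKi.locallyIntegrableOn
            h1.continuous h2 h3)]
        simp only [smul_sub]
      change ∫ t in Ioo 0 T, φ t • (h t - K) = 0
      rw [e2, ← e1, g5])
  filter_upwards [(ae_restrict_iff' measurableSet_Ioo).2 key] with t ht
  exact sub_eq_zero.1 ht

theorem intervalIntegrable_of_integrableOn_Ioo {E : Type*} [NormedAddCommGroup E] (hT : 0 ≤ T)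
    {d : ℝ → E}
    (hd : IntegrableOn d (Ioo 0 T)) : IntervalIntegrable d volume 0 T :=
  (intervalIntegrable_iff_integrableOn_Ioo_of_le hT).2 hd

theorem ae_deriv_primitive {d : ℝ → ℝ} (hd : IntervalIntegrable d volume 0 T) :
    ∀ᵐ t, t ∈ uIoc 0 T → deriv (fun t => ∫ x in (0 : ℝ)..t, d x) t = d t := by
  filter_upwards [hd.ae_hasDerivAt_integral] with t ht h
  exact (ht (uIoc_subset_uIcc h) 0 (by simp)).deriv

/-- Integration by parts for absolutely continuous functions shows that the primitive of `d` has
weak derivative `d`; its difference from `c` then has weak derivative zero. -/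
theorem HasWeakDeriv.exists_ae_eq_primitive_real (hT : 0 < T) {c d : ℝ → ℝ}
    (h : HasWeakDeriv T c d) (hc : IntegrableOn c (Ioo 0 T)) (hd : IntegrableOn d (Ioo 0 T)) :
    ∃ K : ℝ, ∀ᵐ t ∂(volume.restrict (Ioo 0 T)), c t = K + ∫ x in (0 : ℝ)..t, d x := by
  have hd' := intervalIntegrable_of_integrableOn_Ioo hT.le hd
  have hac := hd'.absolutelyContinuousOnInterval_intervalIntegral (c := 0) (by simp)
  have hDi : IntegrableOn (fun t => ∫ x in (0 : ℝ)..t, d x) (Ioo 0 T) := by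
    have := hac.continuousOn
    rw [uIcc_of_le hT.le] at this
    exact (this.integrableOn_compact isCompact_Icc).mono_set Ioo_subset_Icc_self
  obtain ⟨K, hK⟩ := ae_eq_const_of_integral_deriv_smul_eq_zero hT (hc.sub hDi)
    (fun ψ h1 h2 h3 => by
      have e1 : ∫ t in Ioo 0 T, deriv ψ t • (∫ x in (0 : ℝ)..t, d x) =
          -∫ t in Ioo 0 T, ψ t • d t := by
        have e := hac.integral_mul_deriv_eq_deriv_mul
          ((h1.of_le (by simp)).contDiffOn.absolutelyContinuousOnInterval (f := ψ))
        have z0 : ψ 0 = 0 := image_eq_zero_of_notMem_tsupport fun h => lt_irrefl _ (h3 h).1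
        have zT : ψ T = 0 := image_eq_zero_of_notMem_tsupport fun h => lt_irrefl _ (h3 h).2
        rw [z0, zT, mul_zero, mul_zero, sub_zero, zero_sub] at e
        have e2 : ∫ t in (0 : ℝ)..T, deriv (fun t => ∫ x in (0 : ℝ)..t, d x) t * ψ t =
            ∫ t in (0 : ℝ)..T, ψ t • d t := by
          refine intervalIntegral.integral_congr_ae ?_
          filter_upwards [ae_deriv_primitive hd'] with t ht hm
          rw [ht hm, smul_eq_mul, mul_comm]
        rw [e2] at e
        rw [← integral_Ioc_eq_integral_Ioo, ← integral_Ioc_eq_integral_Ioo,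
          ← intervalIntegral.integral_of_le hT.le, ← intervalIntegral.integral_of_le hT.le, ← e]
        simp only [smul_eq_mul, mul_comm]
      simp only [Pi.sub_apply, smul_sub]
      rw [integral_sub (integrableOn_deriv_smul hc h1 h2 h3)
        (integrableOn_deriv_smul hDi h1 h2 h3), e1, h.2 ψ h1 h2 h3]
      ring)
  refine ⟨K, ?_⟩
  filter_upwards [hK] with t ht
  simp only [Pi.sub_apply] at ht
  linarith

theorem HasWeakDeriv.clm_comp {c d : ℝ → ℂ} (L : ℂ →L[ℝ] ℝ) (h : HasWeakDeriv T c d)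
    (hc : IntegrableOn c (Ioo 0 T)) : HasWeakDeriv T (fun t => L (c t)) (fun t => L (d t)) := by
  refine ⟨fun t ht => ?_, fun ψ h1 h2 h3 => ?_⟩
  · obtain ⟨U, hU, hi⟩ := h.1 t ht
    exact ⟨U, hU, L.integrable_comp hi⟩
  · have e := congrArg L (h.2 ψ h1 h2 h3)
    rw [map_neg, ← L.integral_comp_comm (integrableOn_deriv_smul hc h1 h2 h3),
      ← L.integral_comp_comm (integrableOn_smul_of_tsupport_subset measurableSet_Ioo h.1
        h1.continuous h2 h3)] at e
    simpa only [map_smul] using e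

theorem HasWeakDeriv.exists_ae_eq_primitive (hT : 0 < T) {c d : ℝ → ℂ}
    (h : HasWeakDeriv T c d) (hc : IntegrableOn c (Ioo 0 T)) (hd : IntegrableOn d (Ioo 0 T)) :
    ∃ K : ℂ, ∀ᵐ t ∂(volume.restrict (Ioo 0 T)), c t = K + ∫ x in (0 : ℝ)..t, d x := by
  obtain ⟨A, hA⟩ := (h.clm_comp Complex.reCLM hc).exists_ae_eq_primitive_real hT
    (Complex.reCLM.integrable_comp hc) (Complex.reCLM.integrable_comp hd)
  obtain ⟨B, hB⟩ := (h.clm_comp Complex.imCLM hc).exists_ae_eq_primitive_real hT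
    (Complex.imCLM.integrable_comp hc) (Complex.imCLM.integrable_comp hd)
  refine ⟨⟨A, B⟩, ?_⟩
  have hd' := intervalIntegrable_of_integrableOn_Ioo hT.le hd
  filter_upwards [hA, hB, ae_restrict_mem measurableSet_Ioo] with t h1 h2 ht
  have hdt : IntervalIntegrable d volume 0 t := hd'.mono_set (by
    rw [uIcc_of_le hT.le, uIcc_of_le ht.1.le]; exact Icc_subset_Icc_right ht.2.le)
  rw [Complex.reCLM.intervalIntegral_comp_comm hdt] at h1
  rw [Complex.imCLM.intervalIntegral_comp_comm hdt] at h2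
  exact Complex.ext h1 h2

theorem primitive_sq_sub_sq {d : ℝ → ℝ} (hT : 0 ≤ T) (hd : IntervalIntegrable d volume 0 T)
    (K : ℝ) {s t : ℝ} (hs : s ∈ Icc 0 T) (ht : t ∈ Icc 0 T) :
    (K + ∫ x in (0 : ℝ)..t, d x) ^ 2 - (K + ∫ x in (0 : ℝ)..s, d x) ^ 2 =
      ∫ r in s..t, 2 * (d r * (K + ∫ x in (0 : ℝ)..r, d x)) := by
  have hsub : uIcc s t ⊆ uIcc 0 T := by rw [uIcc_of_le hT]; exact uIcc_subset_Icc hs ht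
  have hc : AbsolutelyContinuousOnInterval (fun _ : ℝ => K) s t :=
    contDiff_const.contDiffOn.absolutelyContinuousOnInterval
  have hac : AbsolutelyContinuousOnInterval (fun r => K + ∫ x in (0 : ℝ)..r, d x) s t :=
    hc.add ((hd.absolutelyContinuousOnInterval_intervalIntegral (c := 0) (by simp)).mono hsub)
  have e := hac.integral_deriv_mul_eq_sub hac
  rw [pow_two, pow_two, ← e]
  refine intervalIntegral.integral_congr_ae ?_
  filter_upwards [hd.ae_hasDerivAt_integral] with r hr hm
  have h1 := (hr (hsub (uIoc_subset_uIcc hm)) 0 (by simp)).const_add K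
  have h2 : deriv (fun r => K + ∫ x in (0 : ℝ)..r, d x) r = d r := h1.deriv
  rw [h2]; ring

theorem norm_primitive_sq_sub_sq {d : ℝ → ℂ} (hT : 0 ≤ T) (hd : IntervalIntegrable d volume 0 T)
    (K : ℂ) {s t : ℝ} (hs : s ∈ Icc 0 T) (ht : t ∈ Icc 0 T) :
    ‖K + ∫ x in (0 : ℝ)..t, d x‖ ^ 2 - ‖K + ∫ x in (0 : ℝ)..s, d x‖ ^ 2 =
      ∫ r in s..t, 2 * (d r * (starRingEnd ℂ) (K + ∫ x in (0 : ℝ)..r, d x)).re := by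
  have hsubi : ∀ r ∈ Icc 0 T, IntervalIntegrable d volume 0 r := fun r hr => hd.mono_set (by
    rw [uIcc_of_le hT, uIcc_of_le hr.1]; exact Icc_subset_Icc_right hr.2)
  have hre : IntervalIntegrable (fun x => (d x).re) volume 0 T :=
    ⟨hd.1.re, hd.2.re⟩
  have him : IntervalIntegrable (fun x => (d x).im) volume 0 T :=
    ⟨hd.1.im, hd.2.im⟩
  have e1 : ∀ r ∈ Icc 0 T, (K + ∫ x in (0 : ℝ)..r, d x).re =
      K.re + ∫ x in (0 : ℝ)..r, (d x).re := fun r hr => by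
    rw [Complex.add_re]; congr 1
    exact (Complex.reCLM.intervalIntegral_comp_comm (hsubi r hr)).symm
  have e2 : ∀ r ∈ Icc 0 T, (K + ∫ x in (0 : ℝ)..r, d x).im =
      K.im + ∫ x in (0 : ℝ)..r, (d x).im := fun r hr => by
    rw [Complex.add_im]; congr 1
    exact (Complex.imCLM.intervalIntegral_comp_comm (hsubi r hr)).symm
  have hn : ∀ z : ℂ, ‖z‖ ^ 2 = z.re ^ 2 + z.im ^ 2 := fun z => by
    rw [Complex.sq_norm, Complex.normSq_apply]; ring
  have hsub : uIcc s t ⊆ uIcc 0 T := by rw [uIcc_of_le hT]; exact uIcc_subset_Icc hs ht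
  have hcont : ∀ g : ℝ → ℝ, IntervalIntegrable g volume 0 T → ∀ k : ℝ,
      IntervalIntegrable (fun r => 2 * (g r * (k + ∫ x in (0 : ℝ)..r, g x))) volume s t :=
    fun g hg k => ((hg.mono_set hsub).mul_continuousOn (continuousOn_const.add
      ((hg.absolutelyContinuousOnInterval_intervalIntegral (c := 0)
        (by simp)).continuousOn.mono hsub))).const_mul 2
  rw [hn, hn, e1 t ht, e1 s hs, e2 t ht, e2 s hs]
  have p1 := primitive_sq_sub_sq hT hre K.re hs ht
  have p2 := primitive_sq_sub_sq hT him K.im hs ht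
  have p3 : ∫ r in s..t, 2 * (d r * (starRingEnd ℂ) (K + ∫ x in (0 : ℝ)..r, d x)).re =
      ∫ r in s..t, (2 * ((d r).re * (K.re + ∫ x in (0 : ℝ)..r, (d x).re)) +
        2 * ((d r).im * (K.im + ∫ x in (0 : ℝ)..r, (d x).im))) := by
    refine intervalIntegral.integral_congr fun r hr => ?_
    have hr' : r ∈ Icc 0 T := by rw [← uIcc_of_le hT]; exact hsub hr
    simp only [Complex.mul_re, Complex.conj_re, Complex.conj_im, e1 r hr', e2 r hr']
    ring
  rw [p3, intervalIntegral.integral_add (hcont _ hre _) (hcont _ him _), ← p1, ← p2]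
  ring

end WeakDerivative

/-! ### Sobolev norms and the dual product -/

section Sobolev

variable {n : ℕ}

theorem ofReal_rho_rpow_ne_zero (ξ : Fin n → ℤ) (s : ℝ) : ENNReal.ofReal (rho ξ ^ s) ≠ 0 := by
  have := Real.rpow_pos_of_pos (rho_pos ξ) s
  simpa using this

theorem sum_sq_le_card_mul {ι : Type*} [Fintype ι] (f : ι → ℝ≥0∞) :
    (∑ i, f i) ^ 2 ≤ Fintype.card ι * ∑ i, f i ^ 2 := by
  have := tsum_mul_sq_le (fun _ : ι => 1) f
  simpa [tsum_fintype] using this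

theorem add_sq_le_two_mul (a b : ℝ≥0∞) : (a + b) ^ 2 ≤ 2 * a ^ 2 + 2 * b ^ 2 := by
  have := sum_sq_le_card_mul ![a, b]
  simpa [Fin.sum_univ_two, mul_add] using this

theorem sobolevNormSq_sub_le (s : ℝ) (c d : Coeffs n) :
    sobolevNormSq s (c - d) ≤ 2 * sobolevNormSq s c + 2 * sobolevNormSq s d := by
  unfold sobolevNormSq
  rw [← ENNReal.tsum_mul_left, ← ENNReal.tsum_mul_left, ← ENNReal.tsum_add]
  refine ENNReal.tsum_le_tsum fun ξ => ?_
  calc _ ≤ ENNReal.ofReal (rho ξ ^ (2 * s)) *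
        ∑ k, (2 * ‖c ξ k‖ₑ ^ 2 + 2 * ‖d ξ k‖ₑ ^ 2) := by
        gcongr with k
        exact (pow_le_pow_left₀ zero_le enorm_sub_le 2).trans (add_sq_le_two_mul _ _)
    _ = _ := by
        rw [Finset.sum_add_distrib, ← Finset.mul_sum, ← Finset.mul_sum]; ring

/-- Duality of H^{-s} and H^s: the weights ϱ^{-s} and ϱ^s cancel in the product, and Cauchy–Schwarz
is applied over all pairs of a frequency and a component. -/
theorem tsum_enorm_pairingTerm_sq_le (s : ℝ) (c d : Coeffs n) :
    (∑' ξ, ‖pairingTerm c d ξ‖ₑ) ^ 2 ≤ sobolevNormSq (-s) c * sobolevNormSq s d := by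
  set f : (Fin n → ℤ) × Fin n → ℝ≥0∞ := fun p =>
    ENNReal.ofReal (rho p.1 ^ (-s)) * ‖c p.1 p.2‖ₑ with hf
  set g : (Fin n → ℤ) × Fin n → ℝ≥0∞ := fun p =>
    ENNReal.ofReal (rho p.1 ^ s) * ‖d (-p.1) p.2‖ₑ with hg
  have h1 : ∑' ξ, ‖pairingTerm c d ξ‖ₑ ≤ ∑' p, f p * g p := by
    rw [ENNReal.tsum_prod']
    refine ENNReal.tsum_le_tsum fun ξ => ?_
    rw [tsum_fintype]
    refine (enorm_sum_le _ _).trans (le_of_eq (Finset.sum_congr rfl fun k _ => ?_))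
    rw [enorm_mul]
    have : ENNReal.ofReal (rho ξ ^ (-s)) * ENNReal.ofReal (rho ξ ^ s) = 1 := by
      rw [ofReal_rho_rpow_mul]; simp
    calc _ = (ENNReal.ofReal (rho ξ ^ (-s)) * ENNReal.ofReal (rho ξ ^ s)) *
          (‖c ξ k‖ₑ * ‖d (-ξ) k‖ₑ) := by rw [this, one_mul]
      _ = _ := by simp only [hf, hg]; ring
  have h2 : ∑' p, f p ^ 2 = sobolevNormSq (-s) c := by
    rw [ENNReal.tsum_prod']
    refine tsum_congr fun ξ => ?_
    rw [tsum_fintype, Finset.mul_sum]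
    refine Finset.sum_congr rfl fun k _ => ?_
    rw [hf, mul_pow, pow_two (ENNReal.ofReal _), ofReal_rho_rpow_mul, ← two_mul]
  have h3 : ∑' p, g p ^ 2 = sobolevNormSq s d := by
    rw [ENNReal.tsum_prod']
    unfold sobolevNormSq
    rw [← (Equiv.neg (Fin n → ℤ)).tsum_eq]
    refine tsum_congr fun ξ => ?_
    rw [tsum_fintype, Finset.mul_sum]
    refine Finset.sum_congr rfl fun k _ => ?_
    simp only [hg, Equiv.neg_apply, neg_neg, rho_neg]
    rw [mul_pow, pow_two (ENNReal.ofReal _), ofReal_rho_rpow_mul, ← two_mul]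
  rw [← h2, ← h3]
  exact (pow_le_pow_left₀ zero_le h1 2).trans (tsum_mul_sq_le f g)

theorem summable_of_tsum_enorm_ne_top {ι E : Type*} [NormedAddCommGroup E] [CompleteSpace E]
    {f : ι → E} (h : ∑' i, ‖f i‖ₑ ≠ ⊤) : Summable f := by
  have : Summable fun i => ‖f i‖₊ := ENNReal.tsum_coe_ne_top_iff_summable.1 h
  exact Summable.of_nnnorm this

theorem tsum_enorm_pairingTerm_ne_top {s : ℝ} {c d : Coeffs n} (hc : sobolevNormSq (-s) c < ⊤)
    (hd : sobolevNormSq s d < ⊤) : ∑' ξ, ‖pairingTerm c d ξ‖ₑ ≠ ⊤ := fun h => by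
  have := (tsum_enorm_pairingTerm_sq_le s c d).trans_lt (ENNReal.mul_lt_top hc hd)
  rw [h] at this
  simp at this

theorem enorm_tsum_le_tsum_enorm_of_complete {ι E : Type*} [NormedAddCommGroup E] [CompleteSpace E]
    (f : ι → E) : ‖∑' i, f i‖ₑ ≤ ∑' i, ‖f i‖ₑ := by
  by_cases h : ∑' i, ‖f i‖ₑ = ⊤
  · rw [h]; exact le_top
  · have h1 : Summable fun i => ‖f i‖₊ := ENNReal.tsum_coe_ne_top_iff_summable.1 h
    have h2 := nnnorm_tsum_le h1
    calc ‖∑' i, f i‖ₑ ≤ ((∑' i, ‖f i‖₊ : NNReal) : ℝ≥0∞) := ENNReal.coe_le_coe.2 h2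
      _ = _ := ENNReal.coe_tsum h1

theorem enorm_pairing_le (c d : Coeffs n) : ‖pairing c d‖ₑ ≤ ∑' ξ, ‖pairingTerm c d ξ‖ₑ := by
  refine le_trans ?_ (enorm_tsum_le_tsum_enorm_of_complete _)
  unfold pairing
  rw [enorm_le_iff_norm_le, Real.norm_eq_abs]
  exact Complex.abs_re_le_norm _

theorem enorm_pairing_sq_le (s : ℝ) (c d : Coeffs n) :
    ‖pairing c d‖ₑ ^ 2 ≤ sobolevNormSq (-s) c * sobolevNormSq s d :=
  (pow_le_pow_left₀ zero_le (enorm_pairing_le c d) 2).trans (tsum_enorm_pairingTerm_sq_le s c d)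

theorem sum_enorm_sq_eq_ofReal {ι : Type*} (s : Finset ι) (f : ι → ℂ) :
    ∑ k ∈ s, ‖f k‖ₑ ^ 2 = ENNReal.ofReal (∑ k ∈ s, ‖f k‖ ^ 2) := by
  rw [ENNReal.ofReal_sum_of_nonneg fun _ _ => sq_nonneg _]
  refine Finset.sum_congr rfl fun k _ => ?_
  rw [ENNReal.ofReal_pow (norm_nonneg _), ofReal_norm]

theorem sobolevNormSq_zero_fieldCoeff (v : VField n) :
    sobolevNormSq 0 (fieldCoeff v) = ENNReal.ofReal (‖v‖ ^ 2) := by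
  have h := hasSum_norm_fieldCoeff_sq v
  rw [← h.tsum_eq, ENNReal.ofReal_tsum_of_nonneg (fun _ => by positivity) h.summable]
  refine tsum_congr fun ξ => ?_
  rw [sum_enorm_sq_eq_ofReal]
  simp

theorem summable_norm_sq_of_tsum_enorm_sq_ne_top {ι : Type*} {f : ι → ℂ}
    (h : ∑' i, ‖f i‖ₑ ^ 2 ≠ ⊤) : Summable fun i => ‖f i‖ ^ 2 := by
  have h1 : Summable fun i => (‖f i‖₊ ^ 2 : NNReal) := by
    refine ENNReal.tsum_coe_ne_top_iff_summable.1 ?_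
    simpa [enorm_eq_nnnorm] using h
  have h2 := NNReal.summable_coe.2 h1
  simpa using h2

theorem tsum_enorm_coef_sq {f : UnitAddTorus (Fin n) → ℝ} (hf : MemLp f 2 (torusMeasure n)) :
    ∑' ξ, ‖coef f ξ‖ₑ ^ 2 = ∫⁻ x, ‖f x‖ₑ ^ 2 ∂(torusMeasure n) := by
  have h := hasSum_norm_coef_sq hf
  have h1 : ∑' ξ, ‖coef f ξ‖ₑ ^ 2 = ENNReal.ofReal (∫ x, f x ^ 2 ∂(torusMeasure n)) := by
    rw [← h.tsum_eq, ENNReal.ofReal_tsum_of_nonneg (fun _ => by positivity) h.summable]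
    refine tsum_congr fun ξ => ?_
    rw [ENNReal.ofReal_pow (norm_nonneg _), ofReal_norm]
  rw [h1, ofReal_integral_eq_lintegral_ofReal hf.integrable_sq
    (Eventually.of_forall fun _ => sq_nonneg _)]
  refine lintegral_congr fun x => ?_
  rw [← sq_abs, ENNReal.ofReal_pow (abs_nonneg _), ← Real.norm_eq_abs, ofReal_norm]

end Sobolev

/-! ### Partial derivatives and the viscous form -/

section Viscous

variable {n : ℕ}

theorem enorm_two_pi_I_mul_le (ξ : Fin n → ℤ) (j : Fin n) (z : ℂ) :
    ‖2 * Real.pi * Complex.I * (ξ j : ℂ) * z‖ₑ ≤ ENNReal.ofReal (rho ξ) * ‖z‖ₑ := by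
  rw [enorm_mul]
  gcongr
  rw [← ofReal_norm]
  refine ENNReal.ofReal_le_ofReal ?_
  refine le_trans (le_of_eq ?_) (two_pi_abs_le_rho ξ j)
  simp [abs_of_pos Real.pi_pos]

theorem tsum_enorm_derivative_sq_le (c : Coeffs n) (j k : Fin n) :
    ∑' ξ, ‖2 * Real.pi * Complex.I * (ξ j : ℂ) * c ξ k‖ₑ ^ 2 ≤ sobolevNormSq 1 c := by
  refine ENNReal.tsum_le_tsum fun ξ => ?_
  refine (pow_le_pow_left₀ zero_le (enorm_two_pi_I_mul_le ξ j _) 2).trans ?_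
  rw [mul_pow, ← ENNReal.ofReal_pow (rho_pos ξ).le, ← Real.rpow_natCast, Nat.cast_ofNat, mul_one]
  gcongr
  exact Finset.single_le_sum (f := fun k => ‖c ξ k‖ₑ ^ 2) (fun _ _ => zero_le) (Finset.mem_univ k)

/-- On H¹ the default value 0 of `partialDeriv` is never taken: the prescribed coefficients are
conjugate symmetric and square summable, so they come from a real L₂ function. -/
theorem isPartialDeriv_partialDeriv {v : VField n} (hv : sobolevNormSq 1 (fieldCoeff v) < ⊤)
    (j k : Fin n) : IsPartialDeriv v j k (partialDeriv v j k) := by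
  have hex : ∃ g, IsPartialDeriv v j k g := by
    obtain ⟨f, hf, hfc⟩ := exists_coef_eq
      (fun ξ => 2 * Real.pi * Complex.I * (ξ j : ℂ) * fieldCoeff v ξ k)
      (fun ξ => by
        simp only [map_mul, Complex.conj_I, Complex.conj_ofReal, conj_fieldCoeff, map_ofNat,
          map_intCast, Pi.neg_apply, Int.cast_neg]
        ring)
      (summable_norm_sq_of_tsum_enorm_sq_ne_top
        ((tsum_enorm_derivative_sq_le (fieldCoeff v) j k).trans_lt hv).ne)
    refine ⟨hf.toLp f, fun ξ => ?_⟩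
    rw [← hfc]
    exact coef_congr_ae hf.coeFn_toLp ξ
  unfold partialDeriv
  rw [dif_pos hex]
  exact hex.choose_spec

theorem memLp_partialDeriv (v : VField n) (j k : Fin n) :
    MemLp (fun x => (partialDeriv v j k : UnitAddTorus (Fin n) → ℝ) x) 2 (torusMeasure n) :=
  Lp.memLp _

theorem lintegral_partialDeriv_sq_le {v : VField n} (hv : sobolevNormSq 1 (fieldCoeff v) < ⊤)
    (j k : Fin n) :
    ∫⁻ x, ‖(partialDeriv v j k : UnitAddTorus (Fin n) → ℝ) x‖ₑ ^ 2 ∂(torusMeasure n) ≤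
      sobolevNormSq 1 (fieldCoeff v) := by
  rw [← tsum_enorm_coef_sq (memLp_partialDeriv v j k)]
  refine le_trans (le_of_eq (tsum_congr fun ξ => ?_))
    (tsum_enorm_derivative_sq_le (fieldCoeff v) j k)
  rw [← isPartialDeriv_partialDeriv hv j k ξ]; rfl

theorem memLp_strain (v : VField n) (j β : Fin n) : MemLp (strain v j β) 2 (torusMeasure n) := by
  have := ((memLp_partialDeriv v j β).add (memLp_partialDeriv v β j)).const_mul (1 / 2)
  refine this.ae_eq (Eventually.of_forall fun x => ?_)
  simp only [strain, Pi.add_apply]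
  ring

theorem lintegral_strain_sq_le {v : VField n} (hv : sobolevNormSq 1 (fieldCoeff v) < ⊤)
    (j β : Fin n) :
    ∫⁻ x, ‖strain v j β x‖ₑ ^ 2 ∂(torusMeasure n) ≤ 4 * sobolevNormSq 1 (fieldCoeff v) := by
  have hm : AEMeasurable (fun x => 2 * ‖(partialDeriv v j β : UnitAddTorus (Fin n) → ℝ) x‖ₑ ^ 2)
      (torusMeasure n) :=
    (((memLp_partialDeriv v j β).1.enorm).pow_const 2).const_mul 2
  calc _ ≤ ∫⁻ x, (2 * ‖(partialDeriv v j β : UnitAddTorus (Fin n) → ℝ) x‖ₑ ^ 2 +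
        2 * ‖(partialDeriv v β j : UnitAddTorus (Fin n) → ℝ) x‖ₑ ^ 2) ∂(torusMeasure n) := by
        refine lintegral_mono fun x => ?_
        refine le_trans (pow_le_pow_left₀ zero_le ?_ 2) (add_sq_le_two_mul _ _)
        refine le_trans ?_ (enorm_add_le _ _)
        unfold strain
        rw [enorm_le_iff_norm_le, norm_div, Real.norm_two]
        exact div_le_self (norm_nonneg _) one_le_two
    _ = 2 * (∫⁻ x, ‖(partialDeriv v j β : UnitAddTorus (Fin n) → ℝ) x‖ₑ ^ 2 ∂(torusMeasure n)) +
        2 * (∫⁻ x, ‖(partialDeriv v β j : UnitAddTorus (Fin n) → ℝ) x‖ₑ ^ 2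
          ∂(torusMeasure n)) := by
        rw [lintegral_add_left' hm, lintegral_const_mul' _ _ (by norm_num),
          lintegral_const_mul' _ _ (by norm_num)]
    _ ≤ 2 * sobolevNormSq 1 (fieldCoeff v) + 2 * sobolevNormSq 1 (fieldCoeff v) := by
        gcongr <;> exact lintegral_partialDeriv_sq_le hv _ _
    _ = _ := by rw [← two_mul, ← mul_assoc]; norm_num

theorem lintegral_sum_strain_sq_le {v : VField n} (hv : sobolevNormSq 1 (fieldCoeff v) < ⊤) :
    ∫⁻ x, (∑ p : Fin n × Fin n, ‖strain v p.1 p.2 x‖ₑ) ^ 2 ∂(torusMeasure n) ≤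
      4 * (n : ℝ≥0∞) ^ 4 * sobolevNormSq 1 (fieldCoeff v) := by
  calc _ ≤ ∫⁻ x, (Fintype.card (Fin n × Fin n) : ℝ≥0∞) *
        ∑ p : Fin n × Fin n, ‖strain v p.1 p.2 x‖ₑ ^ 2 ∂(torusMeasure n) :=
        lintegral_mono fun x => sum_sq_le_card_mul _
    _ = (Fintype.card (Fin n × Fin n) : ℝ≥0∞) *
        ∑ p : Fin n × Fin n, ∫⁻ x, ‖strain v p.1 p.2 x‖ₑ ^ 2 ∂(torusMeasure n) := by
        rw [lintegral_const_mul' _ _ (ENNReal.natCast_ne_top _), lintegral_finsetSum']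
        exact fun p _ => (memLp_strain v p.1 p.2).1.enorm.pow_const 2
    _ ≤ (Fintype.card (Fin n × Fin n) : ℝ≥0∞) *
        ∑ p : Fin n × Fin n, 4 * sobolevNormSq 1 (fieldCoeff v) := by
        gcongr; exact lintegral_strain_sq_le hv _ _
    _ = _ := by
        rw [Finset.sum_const, Finset.card_univ, nsmul_eq_mul]
        simp only [Fintype.card_prod, Fintype.card_fin, Nat.cast_mul]
        ring

/-- The fourfold sum is dominated by `M` times a product of two sums over index pairs, to which
Cauchy–Schwarz in x applies. Bounding the integral by the lower integral of the norm requires no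
measurability of the time slices of `a`. -/
theorem enorm_aForm_sq_le {a : Viscosity n} {t : ℝ} {M : ℝ≥0∞}
    (ha : ∀ᵐ x ∂(torusMeasure n), ∀ i j α β, ‖a i j α β (x, t)‖ₑ ≤ M) {v w : VField n}
    (hv : sobolevNormSq 1 (fieldCoeff v) < ⊤) (hw : sobolevNormSq 1 (fieldCoeff w) < ⊤) :
    ‖aForm a t v w‖ₑ ^ 2 ≤ (M * (4 * (n : ℝ≥0∞) ^ 4)) ^ 2 *
      (sobolevNormSq 1 (fieldCoeff v) * sobolevNormSq 1 (fieldCoeff w)) := by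
  have hme : ∀ v : VField n, AEMeasurable (fun x => ∑ p : Fin n × Fin n, ‖strain v p.1 p.2 x‖ₑ)
      (torusMeasure n) := fun v =>
    Finset.aemeasurable_fun_sum _ fun p _ => (memLp_strain v p.1 p.2).1.enorm
  have h1 : ‖aForm a t v w‖ₑ ≤ ∫⁻ x, (M * ∑ p : Fin n × Fin n, ‖strain v p.1 p.2 x‖ₑ) *
      (∑ p : Fin n × Fin n, ‖strain w p.1 p.2 x‖ₑ) ∂(torusMeasure n) := by
    unfold aForm
    refine (enorm_integral_le_lintegral_enorm _).trans (lintegral_mono_ae ?_)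
    filter_upwards [ha] with x hx
    have e : (M * ∑ p : Fin n × Fin n, ‖strain v p.1 p.2 x‖ₑ) *
        (∑ p : Fin n × Fin n, ‖strain w p.1 p.2 x‖ₑ) =
        ∑ i, ∑ j, ∑ α, ∑ β, M * ‖strain v j β x‖ₑ * ‖strain w i α x‖ₑ := by
      simp only [Fintype.sum_prod_type, Finset.mul_sum, Finset.sum_mul]
      refine Finset.sum_congr rfl fun i _ => ?_
      rw [Finset.sum_comm]
    rw [e]
    refine (enorm_sum_le _ _).trans (Finset.sum_le_sum fun i _ => ?_)
    refine (enorm_sum_le _ _).trans (Finset.sum_le_sum fun j _ => ?_)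
    refine (enorm_sum_le _ _).trans (Finset.sum_le_sum fun α _ => ?_)
    refine (enorm_sum_le _ _).trans (Finset.sum_le_sum fun β _ => ?_)
    rw [enorm_mul, enorm_mul]
    gcongr
    exact hx i j α β
  refine (pow_le_pow_left₀ zero_le h1 2).trans ?_
  refine (lintegral_mul_sq_le ((hme v).const_mul M) (hme w)).trans ?_
  simp only [mul_pow M]
  rw [lintegral_const_mul'' _ ((hme v).pow_const 2)]
  calc _ ≤ M ^ 2 * (4 * (n : ℝ≥0∞) ^ 4 * sobolevNormSq 1 (fieldCoeff v)) *
        (4 * (n : ℝ≥0∞) ^ 4 * sobolevNormSq 1 (fieldCoeff w)) := by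
        gcongr
        · exact lintegral_sum_strain_sq_le hv
        · exact lintegral_sum_strain_sq_le hw
    _ = _ := by ring

theorem Viscosity.Bounded.exists_ae_enorm_le {a : Viscosity n} {T : ℝ} (ha : a.Bounded T) :
    ∃ M : ℝ≥0∞, M < ⊤ ∧ ∀ᵐ t ∂(volume.restrict (Ioo 0 T)), ∀ᵐ x ∂(torusMeasure n),
      ∀ i j α β, ‖a i j α β (x, t)‖ₑ ≤ M := by
  set μ := (torusMeasure n).prod (volume.restrict (Ioo 0 T))
  refine ⟨∑ i, ∑ j, ∑ α, ∑ β, eLpNorm (a i j α β) ⊤ μ, ?_, ?_⟩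
  · simp only [ENNReal.sum_lt_top]
    exact fun i _ j _ α _ β _ => (ha i j α β).2
  · have h : ∀ᵐ z ∂μ, ∀ i j α β, ‖a i j α β z‖ₑ ≤
        ∑ i, ∑ j, ∑ α, ∑ β, eLpNorm (a i j α β) ⊤ μ := by
      simp only [ae_all_iff]
      intro i j α β
      have h1 : ∀ᵐ z ∂μ, ‖a i j α β z‖ₑ ≤ eLpNorm (a i j α β) ⊤ μ := by
        rw [eLpNorm_exponent_top]; exact ae_le_eLpNormEssSup
      filter_upwards [h1] with z hz
      refine hz.trans ?_
      refine le_trans ?_ (Finset.single_le_sum (f := fun i => ∑ j, ∑ α, ∑ β,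
        eLpNorm (a i j α β) ⊤ μ) (fun _ _ => zero_le) (Finset.mem_univ i))
      refine le_trans ?_ (Finset.single_le_sum (f := fun j => ∑ α, ∑ β,
        eLpNorm (a i j α β) ⊤ μ) (fun _ _ => zero_le) (Finset.mem_univ j))
      refine le_trans ?_ (Finset.single_le_sum (f := fun α => ∑ β,
        eLpNorm (a i j α β) ⊤ μ) (fun _ _ => zero_le) (Finset.mem_univ α))
      exact Finset.single_le_sum (f := fun β =>
        eLpNorm (a i j α β) ⊤ μ) (fun _ _ => zero_le) (Finset.mem_univ β)
    -- The product measure has space first; the swap is needed to obtain "for a.e. t, for a.e. x".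
    have h2 := (Measure.measurePreserving_swap (μ := volume.restrict (Ioo 0 T))
      (ν := torusMeasure n)).quasiMeasurePreserving.ae h
    exact Measure.ae_ae_of_ae_prod h2

end Viscous

/-! ### The advection term -/

section Advection

variable {n : ℕ}

/-- The sum of the absolute values of the components. -/
noncomputable def absSum (c : Coeffs n) (ξ : Fin n → ℤ) : ℝ≥0∞ := ∑ k, ‖c ξ k‖ₑ

theorem absSum_sq_le (c : Coeffs n) (ξ : Fin n → ℤ) :
    absSum c ξ ^ 2 ≤ n * ∑ k, ‖c ξ k‖ₑ ^ 2 := by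
  have := sum_sq_le_card_mul fun k => ‖c ξ k‖ₑ
  rwa [Fintype.card_fin] at this

theorem tsum_absSum_sq_le (s : ℝ) (c : Coeffs n) :
    ∑' ξ, ENNReal.ofReal (rho ξ ^ (2 * s)) * absSum c ξ ^ 2 ≤ n * sobolevNormSq s c := by
  unfold sobolevNormSq
  rw [← ENNReal.tsum_mul_left]
  refine ENNReal.tsum_le_tsum fun ξ => ?_
  calc _ ≤ ENNReal.ofReal (rho ξ ^ (2 * s)) * (n * ∑ k, ‖c ξ k‖ₑ ^ 2) := by
        gcongr; exact absSum_sq_le c ξ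
    _ = _ := by ring

theorem tsum_absSum_convolution_sq_le (c : Coeffs n) :
    ∑' ξ, (∑' η, absSum c η * absSum c (ξ - η)) ^ 2 ≤
      ENNReal.ofReal (4 * 8 ^ n) * n ^ 2 *
        (sobolevNormSq 0 c * sobolevNormSq ((n : ℝ) / 2) c) := by
  refine (tsum_convolution_sq_le (absSum c)).trans ?_
  have h0 : ∑' ξ, absSum c ξ ^ 2 ≤ n * sobolevNormSq 0 c := by
    simpa using tsum_absSum_sq_le 0 c
  calc _ ≤ ENNReal.ofReal (4 * 8 ^ n) *
        ((n * sobolevNormSq 0 c) * (n * sobolevNormSq ((n : ℝ) / 2) c)) := by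
        gcongr; exact tsum_absSum_sq_le _ c
    _ = _ := by ring

/-- The terms of the convolution series of the advection term. -/
noncomputable def advectionTerm (c : Coeffs n) (ξ η : Fin n → ℤ) (k : Fin n) : ℂ :=
  2 * Real.pi * Complex.I * (∑ j, (ξ j : ℂ) * c η j) * c (ξ - η) k

theorem enorm_sum_freq_mul_le (c : Coeffs n) (ξ η : Fin n → ℤ) :
    ‖2 * Real.pi * Complex.I * ∑ j, (ξ j : ℂ) * c η j‖ₑ ≤
      ENNReal.ofReal (rho ξ) * absSum c η := by
  rw [Finset.mul_sum, absSum, Finset.mul_sum]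
  refine (enorm_sum_le _ _).trans (Finset.sum_le_sum fun j _ => ?_)
  rw [← mul_assoc]
  exact enorm_two_pi_I_mul_le ξ j _

theorem enorm_advectionTerm_le (c : Coeffs n) (ξ η : Fin n → ℤ) (k : Fin n) :
    ‖advectionTerm c ξ η k‖ₑ ≤ ENNReal.ofReal (rho ξ) * (absSum c η * absSum c (ξ - η)) := by
  unfold advectionTerm
  rw [enorm_mul, ← mul_assoc]
  exact mul_le_mul' (enorm_sum_freq_mul_le c ξ η)
    (Finset.single_le_sum (f := fun k => ‖c (ξ - η) k‖ₑ) (fun _ _ => zero_le) (Finset.mem_univ k))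

/-- This is (v·∇)v = div(v⊗v) on the Fourier side. Since η · v̂(η) = 0, the frequency ξ − η of the
derivative may be replaced by ξ, and the derivative costs only ϱ(ξ), which the H⁻¹ weight absorbs.
-/
theorem hasSum_advectionTerm {v : VField n} (hv : sobolevNormSq 1 (fieldCoeff v) < ⊤)
    (hd : DivFree (fieldCoeff v)) (ξ : Fin n → ℤ) (k : Fin n) :
    HasSum (fun η => advectionTerm (fieldCoeff v) ξ η k) (advectionCoeff v ξ k) := by
  have h1 : advectionCoeff v ξ k = ∑ j, coef (fun x =>
      (v : UnitAddTorus (Fin n) → EuclideanSpace ℝ (Fin n)) x j *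
        (partialDeriv v j k : UnitAddTorus (Fin n) → ℝ) x) ξ :=
    coef_sum Finset.univ _
      (fun j _ => (memLp_component v j).integrable_mul (memLp_partialDeriv v j k)) ξ
  rw [h1]
  refine (hasSum_sum fun j _ => hasSum_coef_convolution (memLp_component v j)
    (memLp_partialDeriv v j k) ξ).congr_fun fun η => ?_
  have h2 : ∀ j, coef (fun x => (partialDeriv v j k : UnitAddTorus (Fin n) → ℝ) x) (ξ - η) =
      2 * Real.pi * Complex.I * ((ξ j : ℂ) - η j) * fieldCoeff v (ξ - η) k := fun j => by
    have := isPartialDeriv_partialDeriv hv j k (ξ - η)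
    simp only [Pi.sub_apply, Int.cast_sub] at this
    exact this
  simp only [h2, ← fieldCoeff_eq_coef]
  have h3 := hd η
  unfold advectionTerm
  have h4 : ∑ j, (ξ j : ℂ) * fieldCoeff v η j =
      ∑ j, ((ξ j : ℂ) - η j) * fieldCoeff v η j := by
    simp only [sub_mul, Finset.sum_sub_distrib, h3, sub_zero]
  rw [h4, Finset.mul_sum, Finset.sum_mul]
  refine Finset.sum_congr rfl fun j _ => ?_
  ring

theorem enorm_advectionCoeff_le {v : VField n} (hv : sobolevNormSq 1 (fieldCoeff v) < ⊤)
    (hd : DivFree (fieldCoeff v)) (ξ : Fin n → ℤ) (k : Fin n) :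
    ‖advectionCoeff v ξ k‖ₑ ≤ ENNReal.ofReal (rho ξ) *
      ∑' η, absSum (fieldCoeff v) η * absSum (fieldCoeff v) (ξ - η) := by
  rw [← (hasSum_advectionTerm hv hd ξ k).tsum_eq, ← ENNReal.tsum_mul_left]
  exact (enorm_tsum_le_tsum_enorm_of_complete _).trans
    (ENNReal.tsum_le_tsum fun η => enorm_advectionTerm_le _ ξ η k)

theorem sobolevNormSq_advectionCoeff_le {v : VField n}
    (hv : sobolevNormSq 1 (fieldCoeff v) < ⊤) (hd : DivFree (fieldCoeff v)) :
    sobolevNormSq (-1) (advectionCoeff v) ≤ ENNReal.ofReal (4 * 8 ^ n) * n ^ 3 *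
      (sobolevNormSq 0 (fieldCoeff v) * sobolevNormSq ((n : ℝ) / 2) (fieldCoeff v)) := by
  calc _ ≤ ∑' ξ, n * (∑' η, absSum (fieldCoeff v) η * absSum (fieldCoeff v) (ξ - η)) ^ 2 := by
        refine ENNReal.tsum_le_tsum fun ξ => ?_
        set B := ∑' η, absSum (fieldCoeff v) η * absSum (fieldCoeff v) (ξ - η)
        have h1 : ENNReal.ofReal (rho ξ ^ (2 * (-1 : ℝ))) * ENNReal.ofReal (rho ξ) ^ 2 = 1 := by
          rw [← ENNReal.ofReal_pow (rho_pos ξ).le, ← Real.rpow_natCast, ofReal_rho_rpow_mul]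
          norm_num
        calc _ ≤ ENNReal.ofReal (rho ξ ^ (2 * (-1 : ℝ))) *
              ∑ _k : Fin n, (ENNReal.ofReal (rho ξ) * B) ^ 2 := by
              gcongr with k
              exact enorm_advectionCoeff_le hv hd ξ k
          _ = n * ((ENNReal.ofReal (rho ξ ^ (2 * (-1 : ℝ))) * ENNReal.ofReal (rho ξ) ^ 2) *
              B ^ 2) := by
              rw [Finset.sum_const, Finset.card_univ, Fintype.card_fin, nsmul_eq_mul]; ring
          _ = _ := by rw [h1, one_mul]
    _ ≤ n * (ENNReal.ofReal (4 * 8 ^ n) * n ^ 2 * (sobolevNormSq 0 (fieldCoeff v) *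
        sobolevNormSq ((n : ℝ) / 2) (fieldCoeff v))) := by
        rw [ENNReal.tsum_mul_left]
        gcongr
        exact tsum_absSum_convolution_sq_le _
    _ = _ := by ring

theorem conj_advectionCoeff (v : VField n) (ξ : Fin n → ℤ) (k : Fin n) :
    conj (advectionCoeff v ξ k) = advectionCoeff v (-ξ) k := conj_coef _ ξ

/-! ### The Leray projector -/

theorem leray_meanZero (c : Coeffs n) : MeanZero (leray c) := fun k => by simp [leray]

theorem sum_freq_sq_ne_zero {ξ : Fin n → ℤ} (hξ : ξ ≠ 0) : (∑ j, (ξ j : ℂ) ^ 2) ≠ 0 := by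
  obtain ⟨i, hi⟩ := Function.ne_iff.1 hξ
  have h : (0 : ℤ) < ∑ j, ξ j ^ 2 :=
    Finset.sum_pos' (fun _ _ => sq_nonneg _) ⟨i, Finset.mem_univ i, sq_pos_iff.2 hi⟩
  exact_mod_cast h.ne'

theorem leray_divFree (c : Coeffs n) : DivFree (leray c) := fun ξ => by
  by_cases hξ : ξ = 0
  · simp [hξ]
  · have h := sum_freq_sq_ne_zero hξ
    simp only [leray, if_neg hξ, mul_sub, Finset.sum_sub_distrib]
    have : ∑ k, (ξ k : ℂ) * ((ξ k : ℂ) * (∑ j, (ξ j : ℂ) * c ξ j) / ∑ j, (ξ j : ℂ) ^ 2) =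
        (∑ k, (ξ k : ℂ) ^ 2) * (∑ j, (ξ j : ℂ) * c ξ j) / ∑ j, (ξ j : ℂ) ^ 2 := by
      rw [Finset.sum_mul, Finset.sum_div]
      exact Finset.sum_congr rfl fun k _ => by ring
    rw [this, mul_div_cancel_left₀ _ h, sub_self]

theorem conj_leray {c : Coeffs n} (hc : ∀ ξ k, conj (c ξ k) = c (-ξ) k) (ξ : Fin n → ℤ)
    (k : Fin n) : conj (leray c ξ k) = leray c (-ξ) k := by
  by_cases hξ : ξ = 0
  · simp [leray, hξ]
  · simp only [leray, if_neg hξ, neg_eq_zero, map_sub, map_div₀, map_mul, map_sum, map_pow,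
      map_intCast, hc, Pi.neg_apply, Int.cast_neg, neg_mul, Finset.sum_neg_distrib, mul_neg,
      neg_neg, even_two.neg_pow]

/-- The part removed by the projector is parallel to ξ, hence annihilated by the divergence-free
d(−ξ). At ξ = 0 the mean value of `d` vanishes. -/
theorem pairingTerm_leray (c : Coeffs n) {d : Coeffs n} (h0 : MeanZero d) (hd : DivFree d)
    (ξ : Fin n → ℤ) : pairingTerm (leray c) d ξ = pairingTerm c d ξ := by
  unfold pairingTerm
  by_cases hξ : ξ = 0
  · subst hξ; simp [h0 _]
  · have h := hd (-ξ)
    simp only [Pi.neg_apply, Int.cast_neg, neg_mul, Finset.sum_neg_distrib, neg_eq_zero] at h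
    simp only [leray, if_neg hξ, sub_mul, Finset.sum_sub_distrib]
    have : ∑ k, (ξ k : ℂ) * (∑ j, (ξ j : ℂ) * c ξ j) / (∑ j, (ξ j : ℂ) ^ 2) * d (-ξ) k =
        (∑ k, (ξ k : ℂ) * d (-ξ) k) * ((∑ j, (ξ j : ℂ) * c ξ j) / ∑ j, (ξ j : ℂ) ^ 2) := by
      rw [Finset.sum_mul]
      exact Finset.sum_congr rfl fun k _ => by ring
    rw [this, h, zero_mul, sub_zero]

theorem sum_norm_leray_sq_le (c : Coeffs n) (ξ : Fin n → ℤ) :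
    ∑ k, ‖leray c ξ k‖ ^ 2 ≤ 4 * ∑ k, ‖c ξ k‖ ^ 2 := by
  by_cases hξ : ξ = 0
  · simp only [leray, hξ, if_true, norm_zero, ne_eq, OfNat.ofNat_ne_zero, not_false_eq_true,
      zero_pow, Finset.sum_const_zero]
    positivity
  · set S : ℂ := ∑ j, (ξ j : ℂ) * c ξ j with hS
    set D : ℝ := ∑ j, (ξ j : ℝ) ^ 2 with hD
    have hDc : ∑ j, (ξ j : ℂ) ^ 2 = (D : ℂ) := by rw [hD]; push_cast; rfl
    have hD0 : D ≠ 0 := by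
      have := sum_freq_sq_ne_zero hξ
      rw [hDc] at this; exact_mod_cast this
    have hDpos : 0 < D := lt_of_le_of_ne (Finset.sum_nonneg fun _ _ => sq_nonneg _) hD0.symm
    have hS2 : ‖S‖ ^ 2 ≤ D * ∑ k, ‖c ξ k‖ ^ 2 := by
      have h1 : ‖S‖ ≤ ∑ j, |(ξ j : ℝ)| * ‖c ξ j‖ := by
        refine (norm_sum_le _ _).trans (le_of_eq (Finset.sum_congr rfl fun j _ => ?_))
        rw [norm_mul, Complex.norm_intCast]
      refine (pow_le_pow_left₀ (norm_nonneg _) h1 2).trans ?_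
      refine (Finset.sum_mul_sq_le_sq_mul_sq _ _ _).trans (le_of_eq ?_)
      simp only [sq_abs, hD]
    have h2 : ∀ k, ‖leray c ξ k‖ ^ 2 ≤
        2 * ‖c ξ k‖ ^ 2 + 2 * ((ξ k : ℝ) ^ 2 * (‖S‖ ^ 2 / D ^ 2)) := fun k => by
      have e : ‖(ξ k : ℂ) * S / (D : ℂ)‖ ^ 2 = (ξ k : ℝ) ^ 2 * (‖S‖ ^ 2 / D ^ 2) := by
        rw [norm_div, norm_mul, Complex.norm_intCast, Complex.norm_real, Real.norm_eq_abs,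
          div_pow, mul_pow, sq_abs, sq_abs]
        ring
      simp only [leray, if_neg hξ, ← hS, hDc]
      rw [← e]
      have := norm_sub_le (c ξ k) ((ξ k : ℂ) * S / (D : ℂ))
      nlinarith [norm_nonneg (c ξ k - (ξ k : ℂ) * S / (D : ℂ)),
        sq_nonneg (‖c ξ k‖ - ‖(ξ k : ℂ) * S / (D : ℂ)‖), norm_nonneg (c ξ k),
        norm_nonneg ((ξ k : ℂ) * S / (D : ℂ))]
    have h3 : D * (‖S‖ ^ 2 / D ^ 2) ≤ ∑ k, ‖c ξ k‖ ^ 2 := by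
      rw [show D * (‖S‖ ^ 2 / D ^ 2) = ‖S‖ ^ 2 / D by field_simp, div_le_iff₀ hDpos]
      linarith
    calc _ ≤ ∑ k, (2 * ‖c ξ k‖ ^ 2 + 2 * ((ξ k : ℝ) ^ 2 * (‖S‖ ^ 2 / D ^ 2))) :=
          Finset.sum_le_sum fun k _ => h2 k
      _ = 2 * ∑ k, ‖c ξ k‖ ^ 2 + 2 * (D * (‖S‖ ^ 2 / D ^ 2)) := by
          rw [Finset.sum_add_distrib, ← Finset.mul_sum, ← Finset.mul_sum, ← Finset.sum_mul]
      _ ≤ _ := by linarith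

theorem sobolevNormSq_leray_le (s : ℝ) (c : Coeffs n) :
    sobolevNormSq s (leray c) ≤ 4 * sobolevNormSq s c := by
  unfold sobolevNormSq
  rw [← ENNReal.tsum_mul_left]
  refine ENNReal.tsum_le_tsum fun ξ => ?_
  have h : ∑ k, ‖leray c ξ k‖ₑ ^ 2 ≤ 4 * ∑ k, ‖c ξ k‖ₑ ^ 2 := by
    rw [sum_enorm_sq_eq_ofReal, sum_enorm_sq_eq_ofReal,
      show (4 : ℝ≥0∞) = ENNReal.ofReal 4 by simp, ← ENNReal.ofReal_mul (by norm_num)]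
    exact ENNReal.ofReal_le_ofReal (sum_norm_leray_sq_le c ξ)
  rw [mul_left_comm]
  gcongr

/-! ### Orthogonality of the advection term -/

/-- The terms of the double series of the trilinear form. -/
noncomputable def trilinearTerm (c : Coeffs n) (p : (Fin n → ℤ) × (Fin n → ℤ)) : ℂ :=
  ∑ k, advectionTerm c p.1 p.2 k * c (-p.1) k

theorem enorm_trilinearTerm_le (c : Coeffs n) (ξ η : Fin n → ℤ) :
    ‖trilinearTerm c (ξ, η)‖ₑ ≤
      (ENNReal.ofReal (rho ξ) * absSum c (-ξ)) * (absSum c η * absSum c (ξ - η)) := by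
  refine (enorm_sum_le _ _).trans ?_
  calc _ ≤ ∑ k, ENNReal.ofReal (rho ξ) * (absSum c η * absSum c (ξ - η)) * ‖c (-ξ) k‖ₑ := by
        refine Finset.sum_le_sum fun k _ => ?_
        rw [enorm_mul]
        exact mul_le_mul_left (enorm_advectionTerm_le c ξ η k) _
    _ = _ := by rw [← Finset.mul_sum]; unfold absSum; ring

theorem tsum_rho_mul_absSum_neg_sq_le (c : Coeffs n) :
    ∑' ξ, (ENNReal.ofReal (rho ξ) * absSum c (-ξ)) ^ 2 ≤ n * sobolevNormSq 1 c := by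
  rw [← (Equiv.neg (Fin n → ℤ)).tsum_eq]
  refine le_trans (le_of_eq (tsum_congr fun ξ => ?_)) (tsum_absSum_sq_le 1 c)
  simp only [Equiv.neg_apply, neg_neg, rho_neg]
  rw [mul_pow, ← ENNReal.ofReal_pow (rho_pos ξ).le, ← Real.rpow_natCast, Nat.cast_ofNat, mul_one]

/-- Cauchy–Schwarz in ξ pairs the H¹ norm of one factor with the product estimate for the other two.
Absolute convergence identifies the unordered double sum with the iterated sum appearing in the dual
product. -/
theorem summable_trilinearTerm {c : Coeffs n} (h0 : sobolevNormSq 0 c < ⊤)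
    (h1 : sobolevNormSq 1 c < ⊤) (h2 : sobolevNormSq ((n : ℝ) / 2) c < ⊤) :
    Summable (trilinearTerm c) := by
  refine summable_of_tsum_enorm_ne_top fun htop => ?_
  have hle : ∑' p, ‖trilinearTerm c p‖ₑ ≤ ∑' ξ, (ENNReal.ofReal (rho ξ) * absSum c (-ξ)) *
      ∑' η, absSum c η * absSum c (ξ - η) := by
    rw [ENNReal.tsum_prod']
    refine ENNReal.tsum_le_tsum fun ξ => ?_
    rw [← ENNReal.tsum_mul_left]
    exact ENNReal.tsum_le_tsum fun η => enorm_trilinearTerm_le c ξ η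
  have hcs := (pow_le_pow_left₀ zero_le hle 2).trans (tsum_mul_sq_le _ _)
  have hfin := (tsum_rho_mul_absSum_neg_sq_le c).trans_lt
    (ENNReal.mul_lt_top (ENNReal.natCast_lt_top n) h1)
  have hfin2 := (tsum_absSum_convolution_sq_le c).trans_lt
    (ENNReal.mul_lt_top (ENNReal.mul_lt_top ENNReal.ofReal_lt_top
      (ENNReal.pow_lt_top (ENNReal.natCast_lt_top n))) (ENNReal.mul_lt_top h0 h2))
  have := hcs.trans_lt (ENNReal.mul_lt_top hfin hfin2)
  rw [htop] at this
  simp at this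

/-- The discrete form of ∫ (u·∇)u·u = 0. The involution ξ ↦ η − ξ exchanges the factors c(ξ−η) and
c(−ξ), while (η − ξ)·c(η) = −ξ·c(η) by incompressibility. -/
theorem trilinearTerm_swap {c : Coeffs n} (hd : DivFree c) (ξ η : Fin n → ℤ) :
    trilinearTerm c (η - ξ, η) = -trilinearTerm c (ξ, η) := by
  unfold trilinearTerm advectionTerm
  rw [← Finset.sum_neg_distrib]
  refine Finset.sum_congr rfl fun k _ => ?_
  have h3 := hd η
  simp only [Pi.sub_apply, Int.cast_sub, sub_mul, Finset.sum_sub_distrib, h3, zero_sub,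
    neg_sub, sub_sub_cancel_left]
  ring

theorem tsum_trilinearTerm_eq_zero {c : Coeffs n} (hd : DivFree c) :
    ∑' p, trilinearTerm c p = 0 := by
  let e : (Fin n → ℤ) × (Fin n → ℤ) ≃ (Fin n → ℤ) × (Fin n → ℤ) :=
    ⟨fun p => (p.2 - p.1, p.2), fun p => (p.2 - p.1, p.2),
      fun p => by simp only [sub_sub_cancel], fun p => by simp only [sub_sub_cancel]⟩
  have h3 : ∑' p, trilinearTerm c p = -∑' p, trilinearTerm c p := by
    rw [← tsum_neg, ← e.tsum_eq]
    exact tsum_congr fun p => trilinearTerm_swap hd p.1 p.2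
  exact self_eq_neg.1 h3

theorem hasSum_pairingTerm_of_hasSum_advectionTerm {A c : Coeffs n}
    (hA : ∀ ξ k, HasSum (fun η => advectionTerm c ξ η k) (A ξ k)) (hd : DivFree c)
    (hs : Summable (trilinearTerm c)) : HasSum (pairingTerm A c) 0 := by
  have hsum : HasSum (trilinearTerm c) 0 := tsum_trilinearTerm_eq_zero hd ▸ hs.hasSum
  refine HasSum.prod_fiberwise hsum fun ξ => ?_
  have h : ∀ k ∈ Finset.univ, HasSum (fun η => advectionTerm c ξ η k * c (-ξ) k)
      (A ξ k * c (-ξ) k) := fun k _ => (hA ξ k).mul_right (c (-ξ) k)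
  exact hasSum_sum h

theorem hasSum_pairingTerm_advection_zero {v : VField n}
    (h1 : sobolevNormSq 1 (fieldCoeff v) < ⊤)
    (h2 : sobolevNormSq ((n : ℝ) / 2) (fieldCoeff v) < ⊤) (hd : DivFree (fieldCoeff v)) :
    HasSum (pairingTerm (advectionCoeff v) (fieldCoeff v)) 0 := by
  have h0 : sobolevNormSq 0 (fieldCoeff v) < ⊤ := by
    rw [sobolevNormSq_zero_fieldCoeff]; exact ENNReal.ofReal_lt_top
  exact hasSum_pairingTerm_of_hasSum_advectionTerm (hasSum_advectionTerm h1 hd) hd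
    (summable_trilinearTerm h0 h1 h2)

/-! ### Estimating a functional by its values on test fields -/

open Classical in
/-- The field `ϱ⁻² F` restricted to a finite set of frequencies. -/
noncomputable def dualTruncation (F : Coeffs n) (S : Finset (Fin n → ℤ)) : Coeffs n := fun ξ k =>
  if ξ ∈ S then ((rho ξ ^ (-2 : ℝ) : ℝ) : ℂ) * F ξ k else 0

theorem dualTruncation_of_mem {F : Coeffs n} {S : Finset (Fin n → ℤ)} {ξ : Fin n → ℤ}
    (h : ξ ∈ S) (k : Fin n) :
    dualTruncation F S ξ k = ((rho ξ ^ (-2 : ℝ) : ℝ) : ℂ) * F ξ k := if_pos h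

theorem dualTruncation_of_notMem {F : Coeffs n} {S : Finset (Fin n → ℤ)} {ξ : Fin n → ℤ}
    (h : ξ ∉ S) (k : Fin n) : dualTruncation F S ξ k = 0 := if_neg h

theorem conj_dualTruncation {F : Coeffs n} {S : Finset (Fin n → ℤ)}
    (hconj : ∀ ξ k, conj (F ξ k) = F (-ξ) k) (hS : ∀ ξ, -ξ ∈ S ↔ ξ ∈ S) (ξ : Fin n → ℤ)
    (k : Fin n) : conj (dualTruncation F S ξ k) = dualTruncation F S (-ξ) k := by
  by_cases h : ξ ∈ S
  · rw [dualTruncation_of_mem h, dualTruncation_of_mem ((hS ξ).2 h), map_mul, hconj,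
      Complex.conj_ofReal, rho_neg]
  · rw [dualTruncation_of_notMem h, dualTruncation_of_notMem (fun h' => h ((hS ξ).1 h')),
      map_zero]

theorem sum_weight_nonneg (F : Coeffs n) (s : ℝ) (ξ : Fin n → ℤ) :
    0 ≤ rho ξ ^ s * ∑ k, ‖F ξ k‖ ^ 2 :=
  mul_nonneg (Real.rpow_nonneg (rho_pos ξ).le _) (Finset.sum_nonneg fun _ _ => sq_nonneg _)

theorem sobolevNormSq_one_dualTruncation (F : Coeffs n) (S : Finset (Fin n → ℤ)) :
    sobolevNormSq 1 (dualTruncation F S) =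
      ENNReal.ofReal (∑ ξ ∈ S, rho ξ ^ (-2 : ℝ) * ∑ k, ‖F ξ k‖ ^ 2) := by
  unfold sobolevNormSq
  rw [tsum_eq_sum (s := S) (fun ξ hξ => by simp [dualTruncation_of_notMem hξ]),
    ENNReal.ofReal_sum_of_nonneg fun ξ _ => sum_weight_nonneg F _ ξ]
  refine Finset.sum_congr rfl fun ξ hξ => ?_
  rw [sum_enorm_sq_eq_ofReal, ← ENNReal.ofReal_mul (Real.rpow_nonneg (rho_pos ξ).le _)]
  congr 1
  have hr := Real.rpow_nonneg (rho_pos ξ).le (-2 : ℝ)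
  have e : ∀ k, ‖dualTruncation F S ξ k‖ ^ 2 = (rho ξ ^ (-2 : ℝ)) ^ 2 * ‖F ξ k‖ ^ 2 := fun k => by
    rw [dualTruncation_of_mem hξ, norm_mul, mul_pow, Complex.norm_real, Real.norm_of_nonneg hr]
  simp only [e]
  rw [← Finset.mul_sum, ← mul_assoc, pow_two, ← Real.rpow_add (rho_pos ξ),
    ← Real.rpow_add (rho_pos ξ)]
  norm_num

theorem dualTruncation_divFree {F : Coeffs n} (hd : DivFree F) (S : Finset (Fin n → ℤ)) :
    DivFree (dualTruncation F S) := fun ξ => by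
  by_cases h : ξ ∈ S
  · simp only [dualTruncation_of_mem h, mul_left_comm _ ((rho ξ ^ (-2 : ℝ) : ℝ) : ℂ),
      ← Finset.mul_sum]
    rw [hd ξ, mul_zero]
  · simp only [dualTruncation_of_notMem h, mul_zero, Finset.sum_const_zero]

theorem dualTruncation_meanZero {F : Coeffs n} (h0 : MeanZero F) (S : Finset (Fin n → ℤ)) :
    MeanZero (dualTruncation F S) := fun k => by
  by_cases h : (0 : Fin n → ℤ) ∈ S
  · rw [dualTruncation_of_mem h, h0, mul_zero]
  · exact dualTruncation_of_notMem h k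

theorem hasSum_pairingTerm_dualTruncation {F : Coeffs n} {S : Finset (Fin n → ℤ)}
    (hconj : ∀ ξ k, conj (F ξ k) = F (-ξ) k) (hS : ∀ ξ, -ξ ∈ S ↔ ξ ∈ S) :
    HasSum (pairingTerm F (dualTruncation F S))
      ((∑ ξ ∈ S, rho ξ ^ (-2 : ℝ) * ∑ k, ‖F ξ k‖ ^ 2 : ℝ) : ℂ) := by
  have e : ((∑ ξ ∈ S, rho ξ ^ (-2 : ℝ) * ∑ k, ‖F ξ k‖ ^ 2 : ℝ) : ℂ) =
      ∑ ξ ∈ S, pairingTerm F (dualTruncation F S) ξ := by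
    rw [Complex.ofReal_sum]
    refine Finset.sum_congr rfl fun ξ hξ => ?_
    unfold pairingTerm
    rw [Complex.ofReal_mul, Complex.ofReal_sum, Finset.mul_sum]
    refine Finset.sum_congr rfl fun k _ => ?_
    rw [dualTruncation_of_mem ((hS ξ).2 hξ), ← hconj, rho_neg, Complex.ofReal_pow,
      ← Complex.mul_conj']
    ring
  rw [e]
  refine hasSum_sum_of_ne_finset_zero fun ξ hξ => ?_
  unfold pairingTerm
  exact Finset.sum_eq_zero fun k _ => by
    rw [dualTruncation_of_notMem (fun h' => hξ ((hS ξ).1 h')), mul_zero]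

open Classical in
theorem exists_symmetric_superset (S : Finset (Fin n → ℤ)) :
    ∃ S' : Finset (Fin n → ℤ), S ⊆ S' ∧ ∀ ξ, -ξ ∈ S' ↔ ξ ∈ S' := by
  refine ⟨S ∪ S.image (fun ξ => -ξ), Finset.subset_union_left, fun ξ => ?_⟩
  simp only [Finset.mem_union, Finset.mem_image]
  constructor
  · rintro (h | ⟨η, h, e⟩)
    · exact Or.inr ⟨-ξ, h, neg_neg ξ⟩
    · exact Or.inl (neg_injective e ▸ h)
  · rintro (h | ⟨η, h, e⟩)
    · exact Or.inr ⟨ξ, h, rfl⟩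
    · exact Or.inl (by rw [← e, neg_neg]; exact h)

/-- The test field is the Riesz representative ϱ⁻²F cut off to finitely many frequencies. Both its
pairing with `F` and its squared H¹ norm equal the truncated squared H⁻¹ norm X, so X² ≤ G·X. The
frequency set is symmetric so that the field is real; `h0` and `hd` make it an admissible test
field. -/
theorem sobolevNormSq_neg_one_le_of_pairing_le {F : Coeffs n}
    (hconj : ∀ ξ k, conj (F ξ k) = F (-ξ) k) (h0 : MeanZero F) (hd : DivFree F) {G : ℝ≥0∞}
    (hG : ∀ w : VField n, MemHSigma 1 (fieldCoeff w) → ∃ r : ℝ,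
      HasSum (pairingTerm F (fieldCoeff w)) (r : ℂ) ∧
        ‖r‖ₑ ^ 2 ≤ G * sobolevNormSq 1 (fieldCoeff w)) :
    sobolevNormSq (-1) F ≤ G := by
  unfold sobolevNormSq
  rw [ENNReal.tsum_eq_iSup_sum]
  refine iSup_le fun S₀ => ?_
  obtain ⟨S, hsub, hS⟩ := exists_symmetric_superset S₀
  refine (Finset.sum_le_sum_of_subset hsub).trans ?_
  obtain ⟨w, hw⟩ := exists_fieldCoeff_eq (dualTruncation F S) (conj_dualTruncation hconj hS)
    (summable_of_ne_finset_zero (s := S) fun ξ hξ => by simp [dualTruncation_of_notMem hξ])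
  have hN := sobolevNormSq_one_dualTruncation F S
  have hp := hasSum_pairingTerm_dualTruncation hconj hS
  have hgoal : ∑ ξ ∈ S, ENNReal.ofReal (rho ξ ^ (2 * (-1 : ℝ))) * ∑ k, ‖F ξ k‖ₑ ^ 2 =
      ENNReal.ofReal (∑ ξ ∈ S, rho ξ ^ (-2 : ℝ) * ∑ k, ‖F ξ k‖ ^ 2) := by
    rw [ENNReal.ofReal_sum_of_nonneg fun ξ _ => sum_weight_nonneg F _ ξ]
    refine Finset.sum_congr rfl fun ξ _ => ?_
    rw [sum_enorm_sq_eq_ofReal, ← ENNReal.ofReal_mul (Real.rpow_nonneg (rho_pos ξ).le _)]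
    norm_num
  have hX0 : 0 ≤ ∑ ξ ∈ S, rho ξ ^ (-2 : ℝ) * ∑ k, ‖F ξ k‖ ^ 2 :=
    Finset.sum_nonneg fun ξ _ => sum_weight_nonneg F _ ξ
  rw [hgoal]
  generalize (∑ ξ ∈ S, rho ξ ^ (-2 : ℝ) * ∑ k, ‖F ξ k‖ ^ 2 : ℝ) = X at *
  obtain ⟨r, hr, hrG⟩ := hG w (by
    rw [hw]
    exact ⟨hN ▸ ENNReal.ofReal_lt_top, dualTruncation_meanZero h0 S, dualTruncation_divFree hd S⟩)
  rw [hw] at hr hrG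
  have hreq : r = X := Complex.ofReal_injective (hr.unique hp)
  rw [hN, hreq, Real.enorm_eq_ofReal hX0, pow_two] at hrG
  rcases eq_or_ne (ENNReal.ofReal X) 0 with hz | hz
  · rw [hz]; exact zero_le
  · exact (ENNReal.mul_le_mul_iff_left hz ENNReal.ofReal_ne_top).1 hrG

end Advection

/-! ### Time dependent Fourier coefficients -/

section Time

variable {n : ℕ} {T : ℝ}

/-- Gives measurability in time of the advection coefficients and of the dual product from that of
single coefficients, without joint measurability in (x, t). -/
theorem aemeasurable_of_hasSum {α ι : Type*} [MeasurableSpace α] {μ : Measure α} [Countable ι]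
    {f : ι → α → ℂ} {g : α → ℂ} (hf : ∀ i, AEMeasurable (f i) μ)
    (h : ∀ᵐ x ∂μ, HasSum (fun i => f i x) (g x)) : AEMeasurable g μ :=
  aemeasurable_of_tendsto_metrizable_ae (u := atTop)
    (f := fun (s : Finset ι) x => ∑ i ∈ s, f i x)
    (fun s => Finset.aemeasurable_fun_sum s fun i _ => hf i) h

theorem aemeasurable_sobolevNormSq {μ : Measure ℝ} {c : ℝ → Coeffs n}
    (hc : ∀ ξ k, AEMeasurable (fun t => c t ξ k) μ) (s : ℝ) :
    AEMeasurable (fun t => sobolevNormSq s (c t)) μ :=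
  AEMeasurable.tsum fun ξ =>
    (Finset.aemeasurable_fun_sum _ fun k _ => ((hc ξ k).enorm).pow_const 2).const_mul _

theorem MemL2H.ae_lt_top {s : ℝ} {c : ℝ → Coeffs n} (hc : MemL2H T s c) :
    ∀ᵐ t ∂(volume.restrict (Ioo 0 T)), sobolevNormSq s (c t) < ⊤ :=
  ae_lt_top' (aemeasurable_sobolevNormSq hc.measurable s) hc.finite.ne

theorem enorm_sq_le_sobolevNormSq (s : ℝ) (c : Coeffs n) (ξ : Fin n → ℤ) (k : Fin n) :
    ENNReal.ofReal (rho ξ ^ (2 * s)) * ‖c ξ k‖ₑ ^ 2 ≤ sobolevNormSq s c := by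
  refine le_trans ?_ (ENNReal.le_tsum ξ)
  gcongr
  exact Finset.single_le_sum (f := fun k => ‖c ξ k‖ₑ ^ 2) (fun _ _ => zero_le) (Finset.mem_univ k)

theorem MemL2H.integrableOn {s : ℝ} {c : ℝ → Coeffs n} (hc : MemL2H T s c) (ξ : Fin n → ℤ)
    (k : Fin n) : IntegrableOn (fun t => c t ξ k) (Ioo 0 T) := by
  have hm := (hc.measurable ξ k).aestronglyMeasurable
  have h1 : ENNReal.ofReal (rho ξ ^ (2 * s)) * ∫⁻ t in Ioo 0 T, ‖c t ξ k‖ₑ ^ 2 < ⊤ := by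
    rw [← lintegral_const_mul' _ _ ENNReal.ofReal_ne_top]
    exact (lintegral_mono fun t => enorm_sq_le_sobolevNormSq s (c t) ξ k).trans_lt hc.finite
  have h2 : ∫⁻ t in Ioo 0 T, ‖c t ξ k‖ₑ ^ 2 < ⊤ :=
    ENNReal.lt_top_of_mul_ne_top_right h1.ne (ofReal_rho_rpow_ne_zero ξ _)
  have h3 : MemLp (fun t => c t ξ k) 2 (volume.restrict (Ioo 0 T)) := by
    refine ⟨hm, ?_⟩
    rw [eLpNorm_lt_top_iff_lintegral_rpow_enorm_lt_top (by norm_num) (by norm_num)]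
    simpa using h2
  exact h3.integrable (by norm_num)

theorem MemL2H.congr_ae {s : ℝ} {c c' : ℝ → Coeffs n} (hc : MemL2H T s c)
    (h : ∀ᵐ t ∂(volume.restrict (Ioo 0 T)), c t = c' t) : MemL2H T s c' := by
  refine ⟨fun ξ k => (hc.measurable ξ k).congr ?_, ?_⟩
  · filter_upwards [h] with t ht
    rw [ht]
  · refine lt_of_eq_of_lt (lintegral_congr_ae ?_) hc.finite
    filter_upwards [h] with t ht
    rw [ht]

theorem le_add_of_sq_le_mul {x a b : ℝ≥0∞} (h : x ^ 2 ≤ a * b) : x ≤ a + b := by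
  refine (ENNReal.pow_le_pow_left_iff two_ne_zero).1 (h.trans ?_)
  rw [pow_two]
  exact mul_le_mul' le_self_add le_add_self

theorem aemeasurable_pairingTerm {μ : Measure ℝ} {c d : ℝ → Coeffs n}
    (hc : ∀ ξ k, AEMeasurable (fun t => c t ξ k) μ)
    (hd : ∀ ξ k, AEMeasurable (fun t => d t ξ k) μ) (ξ : Fin n → ℤ) :
    AEMeasurable (fun t => pairingTerm (c t) (d t) ξ) μ :=
  Finset.aemeasurable_fun_sum _ fun k _ => (hc ξ k).mul (hd (-ξ) k)

theorem lintegral_tsum_pairingTerm_lt_top {s : ℝ} {c d : ℝ → Coeffs n} (hc : MemL2H T (-s) c)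
    (hd : MemL2H T s d) :
    ∫⁻ t in Ioo 0 T, ∑' ξ, ‖pairingTerm (c t) (d t) ξ‖ₑ < ⊤ := by
  calc _ ≤ ∫⁻ t in Ioo 0 T, (sobolevNormSq (-s) (c t) + sobolevNormSq s (d t)) :=
        lintegral_mono fun t => le_add_of_sq_le_mul (tsum_enorm_pairingTerm_sq_le s (c t) (d t))
    _ = (∫⁻ t in Ioo 0 T, sobolevNormSq (-s) (c t)) + ∫⁻ t in Ioo 0 T, sobolevNormSq s (d t) :=
        lintegral_add_left' (aemeasurable_sobolevNormSq hc.measurable _) _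
    _ < ⊤ := ENNReal.add_lt_top.2 ⟨hc.finite, hd.finite⟩

theorem ae_summable_pairingTerm {s : ℝ} {c d : ℝ → Coeffs n} (hc : MemL2H T (-s) c)
    (hd : MemL2H T s d) :
    ∀ᵐ t ∂(volume.restrict (Ioo 0 T)), Summable (pairingTerm (c t) (d t)) := by
  filter_upwards [hc.ae_lt_top, hd.ae_lt_top] with t h1 h2
  exact summable_of_tsum_enorm_ne_top (tsum_enorm_pairingTerm_ne_top h1 h2)

theorem integrableOn_pairing {s : ℝ} {c d : ℝ → Coeffs n} (hc : MemL2H T (-s) c)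
    (hd : MemL2H T s d) : IntegrableOn (fun t => pairing (c t) (d t)) (Ioo 0 T) := by
  have hm : AEMeasurable (fun t => ∑' ξ, pairingTerm (c t) (d t) ξ) (volume.restrict (Ioo 0 T)) :=
    aemeasurable_of_hasSum (aemeasurable_pairingTerm hc.measurable hd.measurable) (by
      filter_upwards [ae_summable_pairingTerm hc hd] with t ht
      exact ht.hasSum)
  refine ⟨(Complex.measurable_re.comp_aemeasurable hm).aestronglyMeasurable, ?_⟩
  exact (lintegral_mono fun t => enorm_pairing_le (c t) (d t)).trans_lt
    (lintegral_tsum_pairingTerm_lt_top hc hd)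

theorem cosTest_neg (ξ : Fin n → ℤ) : cosTest (-ξ) = cosTest ξ := by
  ext x
  change Real.cos (phase (-ξ) x) = Real.cos (phase ξ x)
  rw [← Real.cos_neg]
  congr 1
  simp [phase]

theorem sinTest_neg (ξ : Fin n → ℤ) : sinTest (-ξ) = -sinTest ξ := by
  ext x
  change Real.sin (phase (-ξ) x) = -Real.sin (phase ξ x)
  rw [← Real.sin_neg]
  congr 1
  simp [phase]

theorem conj_distCoeff (g : Fin n → TorusDistribution n) (ξ : Fin n → ℤ) (k : Fin n) :
    conj (distCoeff g ξ k) = distCoeff g (-ξ) k := by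
  simp only [distCoeff, cosTest_neg, sinTest_neg, map_neg, map_sub, map_mul, Complex.conj_I,
    Complex.conj_ofReal, Complex.ofReal_neg]
  ring

theorem IsTimeDeriv.hasWeakDeriv {u : ℝ → VField n} {u' : ℝ → Fin n → TorusDistribution n}
    (h : IsTimeDeriv T u u') (ξ : Fin n → ℤ) (k : Fin n) :
    HasWeakDeriv T (fun t => fieldCoeff (u t) ξ k) (fun t => distCoeff (u' t) ξ k) :=
  ⟨(h ξ k).1, fun ψ h1 h2 h3 => by
    simp only [Complex.real_smul]
    exact (h ξ k).2 ψ h1 h2 h3⟩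

/-- A linear constraint on the coefficients passes to the time derivative, because the zero function
has only the zero weak derivative. `ae_divFree_of_hasWeakDeriv` rests on the same principle. -/
theorem ae_meanZero_of_hasWeakDeriv {s : ℝ} {c d : ℝ → Coeffs n} (hc : MemL2HDot T s c)
    (h : ∀ ξ k, HasWeakDeriv T (fun t => c t ξ k) (fun t => d t ξ k)) :
    ∀ᵐ t ∂(volume.restrict (Ioo 0 T)), MeanZero (d t) := by
  refine ae_all_iff.2 fun k => ?_
  have h1 : HasWeakDeriv T (0 : ℝ → ℂ) (fun t => d t 0 k) := (h 0 k).congr_ae (by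
    filter_upwards [hc.meanZero] with t ht
    exact ht k)
  exact h1.unique HasWeakDeriv.zero

theorem ae_divFree_of_hasWeakDeriv {s : ℝ} {c d : ℝ → Coeffs n} (hc : MemL2HSigma T s c)
    (h : ∀ ξ k, HasWeakDeriv T (fun t => c t ξ k) (fun t => d t ξ k)) :
    ∀ᵐ t ∂(volume.restrict (Ioo 0 T)), DivFree (d t) := by
  refine ae_all_iff.2 fun ξ => ?_
  have h1 := HasWeakDeriv.sum_const_mul Finset.univ (fun k => (ξ k : ℂ))
    (fun k _ => hc.integrableOn ξ k) (fun k _ => h ξ k)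
  have h2 : HasWeakDeriv T (0 : ℝ → ℂ) (fun t => ∑ k, (ξ k : ℂ) * d t ξ k) := h1.congr_ae (by
    filter_upwards [hc.divFree] with t ht
    exact ht ξ)
  exact h2.unique HasWeakDeriv.zero

theorem ae_eq_of_hasWeakDeriv {c d d' : ℝ → Coeffs n}
    (h : ∀ ξ k, HasWeakDeriv T (fun t => c t ξ k) (fun t => d t ξ k))
    (h' : ∀ ξ k, HasWeakDeriv T (fun t => c t ξ k) (fun t => d' t ξ k)) :
    ∀ᵐ t ∂(volume.restrict (Ioo 0 T)), d t = d' t := by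
  have : ∀ᵐ t ∂(volume.restrict (Ioo 0 T)), ∀ ξ k, d t ξ k = d' t ξ k :=
    ae_all_iff.2 fun ξ => ae_all_iff.2 fun k => (h ξ k).unique (h' ξ k)
  filter_upwards [this] with t ht
  exact funext fun ξ => funext fun k => ht ξ k

end Time

/-! ### The continuous version -/

section ContinuousVersion

variable {n : ℕ} {T : ℝ}

/-- Used to carry reality, zero mean and zero divergence from almost every time to every time,
endpoints included. -/
theorem eqOn_Icc_of_ae_eq_Ioo (hT : 0 < T) {f g : ℝ → ℂ}
    (h : ∀ᵐ t ∂(volume.restrict (Ioo 0 T)), f t = g t) (hf : ContinuousOn f (Icc 0 T))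
    (hg : ContinuousOn g (Icc 0 T)) : EqOn f g (Icc 0 T) :=
  Measure.eqOn_Icc_of_ae_eq volume hT.ne
    (by rwa [← Measure.restrict_congr_set (Ioo_ae_eq_Icc (μ := volume))]) hf hg

theorem continuousOn_primitive_Icc (hT : 0 < T) {d : ℝ → ℂ} (hd : IntegrableOn d (Ioo 0 T))
    (K : ℂ) : ContinuousOn (fun t => K + ∫ x in (0 : ℝ)..t, d x) (Icc 0 T) := by
  have h := intervalIntegral.continuousOn_primitive_interval' (b₁ := 0) (b₂ := T) (a := 0)
    (intervalIntegrable_of_integrableOn_Ioo hT.le hd) (by simp)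
  rw [uIcc_of_le hT.le] at h
  exact continuousOn_const.add h

/-- Absolutely continuous Fourier coefficients `C` of a field in `L₂(0,T; Ḣ¹_σ)` with Fourier
coefficients `c`, whose time derivative in `L₂(0,T; H⁻¹)` has Fourier coefficients `d`. -/
structure IsPrimitive (T : ℝ) (c d C : ℝ → Coeffs n) : Prop where
  pos : 0 < T
  memL2 : MemL2HSigma T 1 c
  conj_eq : ∀ t ξ k, conj (c t ξ k) = c t (-ξ) k
  memL2_deriv : MemL2H T (-1) d
  eq_primitive : ∃ K : Coeffs n, ∀ t ξ k, C t ξ k = K ξ k + ∫ x in (0 : ℝ)..t, d x ξ k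
  ae_eq : ∀ᵐ t ∂(volume.restrict (Ioo 0 T)), C t = c t

theorem exists_isPrimitive (hT : 0 < T) {c d : ℝ → Coeffs n} (hc : MemL2HSigma T 1 c)
    (hconj : ∀ t ξ k, conj (c t ξ k) = c t (-ξ) k) (hd : MemL2H T (-1) d)
    (h : ∀ ξ k, HasWeakDeriv T (fun t => c t ξ k) (fun t => d t ξ k)) :
    ∃ C, IsPrimitive T c d C := by
  choose K hK using fun ξ k =>
    (h ξ k).exists_ae_eq_primitive hT (hc.integrableOn ξ k) (hd.integrableOn ξ k)
  refine ⟨fun t ξ k => K ξ k + ∫ x in (0 : ℝ)..t, d x ξ k, hT, hc, hconj, hd,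
    ⟨K, fun t ξ k => rfl⟩, ?_⟩
  filter_upwards [ae_all_iff.2 fun ξ => ae_all_iff.2 fun k => hK ξ k] with t ht
  exact funext fun ξ => funext fun k => (ht ξ k).symm

namespace IsPrimitive

variable {c d C : ℝ → Coeffs n}

theorem continuousOn (h : IsPrimitive T c d C) (ξ : Fin n → ℤ) (k : Fin n) :
    ContinuousOn (fun t => C t ξ k) (Icc 0 T) := by
  obtain ⟨K, hK⟩ := h.eq_primitive
  simp only [hK]
  exact continuousOn_primitive_Icc h.pos (h.memL2_deriv.integrableOn ξ k) _

theorem conj_coeff (h : IsPrimitive T c d C) {t : ℝ} (ht : t ∈ Icc 0 T) (ξ : Fin n → ℤ)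
    (k : Fin n) : conj (C t ξ k) = C t (-ξ) k := by
  refine eqOn_Icc_of_ae_eq_Ioo h.pos (f := fun t => conj (C t ξ k)) ?_
    (Complex.continuous_conj.comp_continuousOn (h.continuousOn ξ k)) (h.continuousOn (-ξ) k) ht
  filter_upwards [h.ae_eq] with t ht
  rw [ht, h.conj_eq]

theorem meanZero (h : IsPrimitive T c d C) {t : ℝ} (ht : t ∈ Icc 0 T) : MeanZero (C t) := fun k =>
  eqOn_Icc_of_ae_eq_Ioo h.pos (f := fun t => C t 0 k) (g := fun _ => 0) (by
    filter_upwards [h.ae_eq, h.memL2.meanZero] with t h1 h2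
    rw [h1, h2]) (h.continuousOn 0 k) continuousOn_const ht

theorem divFree (h : IsPrimitive T c d C) {t : ℝ} (ht : t ∈ Icc 0 T) : DivFree (C t) := fun ξ =>
  eqOn_Icc_of_ae_eq_Ioo h.pos (f := fun t => ∑ k, (ξ k : ℂ) * C t ξ k) (g := fun _ => 0) (by
    filter_upwards [h.ae_eq, h.memL2.divFree] with t h1 h2
    rw [h1, h2]) (continuousOn_finsetSum _ fun k _ => continuousOn_const.mul (h.continuousOn ξ k))
    continuousOn_const ht

theorem sq_sub_sq (h : IsPrimitive T c d C) {s t : ℝ} (hs : 0 ≤ s) (hst : s ≤ t) (ht : t ≤ T)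
    (ξ : Fin n → ℤ) :
    ∑ k, ‖C t ξ k‖ ^ 2 - ∑ k, ‖C s ξ k‖ ^ 2 =
      ∫ r in Ioc s t, 2 * (pairingTerm (d r) (c r) ξ).re := by
  obtain ⟨K, hK⟩ := h.eq_primitive
  have hsT : s ∈ Icc 0 T := ⟨hs, hst.trans ht⟩
  have htT : t ∈ Icc 0 T := ⟨hs.trans hst, ht⟩
  have hdi : ∀ k, IntervalIntegrable (fun r => d r ξ k) volume 0 T := fun k =>
    intervalIntegrable_of_integrableOn_Ioo h.pos.le (h.memL2_deriv.integrableOn ξ k)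
  have hsub : uIcc s t ⊆ uIcc 0 T := by rw [uIcc_of_le h.pos.le]; exact uIcc_subset_Icc hsT htT
  have hi : ∀ k, IntervalIntegrable (fun r => 2 * (d r ξ k * conj (C r ξ k)).re) volume s t := by
    intro k
    have hcont : ContinuousOn (fun r => conj (C r ξ k)) (uIcc s t) :=
      (Complex.continuous_conj.comp_continuousOn (h.continuousOn ξ k)).mono
        (by rw [← uIcc_of_le h.pos.le]; exact hsub)
    have h1 := ((hdi k).mono_set hsub).mul_continuousOn hcont
    exact IntervalIntegrable.const_mul ⟨h1.1.re, h1.2.re⟩ 2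
  have e1 : ∑ k, ‖C t ξ k‖ ^ 2 - ∑ k, ‖C s ξ k‖ ^ 2 =
      ∑ k, ∫ r in s..t, 2 * (d r ξ k * conj (C r ξ k)).re := by
    rw [← Finset.sum_sub_distrib]
    refine Finset.sum_congr rfl fun k _ => ?_
    have := norm_primitive_sq_sub_sq h.pos.le (hdi k) (K ξ k) hsT htT
    simp only [hK]
    exact this
  rw [e1, ← intervalIntegral.integral_finsetSum fun k _ => hi k,
    intervalIntegral.integral_of_le hst]
  have hae : ∀ᵐ r ∂(volume.restrict (Ioc s t)), C r = c r := by
    refine ae_restrict_of_ae_restrict_of_subset (t := Icc 0 T)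
      (fun r hr => ⟨hs.trans hr.1.le, hr.2.trans ht⟩) ?_
    rw [← Measure.restrict_congr_set (Ioo_ae_eq_Icc (μ := volume))]
    exact h.ae_eq
  refine integral_congr_ae ?_
  filter_upwards [hae] with r hr
  -- Reality of the field turns the conjugate at ξ into the coefficient at −ξ, which produces the
  -- dual product term.
  simp only [hr, h.conj_eq]
  rw [← Finset.mul_sum, ← Complex.re_sum]
  rfl

theorem tsum_integral_lt_top (h : IsPrimitive T c d C) :
    ∑' ξ, ∫⁻ r in Ioo 0 T, ‖2 * (pairingTerm (d r) (c r) ξ).re‖ₑ < ⊤ := by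
  have hm : ∀ ξ, AEMeasurable (fun r => ‖pairingTerm (d r) (c r) ξ‖ₑ)
      (volume.restrict (Ioo 0 T)) := fun ξ =>
    (aemeasurable_pairingTerm h.memL2_deriv.measurable h.memL2.measurable ξ).enorm
  calc _ ≤ ∑' ξ, 2 * ∫⁻ r in Ioo 0 T, ‖pairingTerm (d r) (c r) ξ‖ₑ := by
        refine ENNReal.tsum_le_tsum fun ξ => ?_
        rw [← lintegral_const_mul' _ _ (by norm_num)]
        refine lintegral_mono fun r => ?_
        rw [enorm_mul]
        gcongr
        · rw [Real.enorm_eq_ofReal (by norm_num)]; simp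
        · rw [enorm_le_iff_norm_le, Real.norm_eq_abs]
          exact Complex.abs_re_le_norm _
    _ = 2 * ∫⁻ r in Ioo 0 T, ∑' ξ, ‖pairingTerm (d r) (c r) ξ‖ₑ := by
        rw [ENNReal.tsum_mul_left, lintegral_tsum hm]
    _ < ⊤ := ENNReal.mul_lt_top (by norm_num)
        (lintegral_tsum_pairingTerm_lt_top h.memL2_deriv h.memL2.toMemL2H)

theorem integrableOn_term (h : IsPrimitive T c d C) (ξ : Fin n → ℤ) :
    IntegrableOn (fun r => 2 * (pairingTerm (d r) (c r) ξ).re) (Ioc 0 T) := by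
  rw [integrableOn_Ioc_iff_integrableOn_Ioo]
  refine ⟨((Complex.measurable_re.comp_aemeasurable (aemeasurable_pairingTerm
    h.memL2_deriv.measurable h.memL2.measurable ξ)).const_mul 2).aestronglyMeasurable, ?_⟩
  exact (ENNReal.le_tsum ξ).trans_lt h.tsum_integral_lt_top

theorem summable_integral_norm (h : IsPrimitive T c d C) :
    Summable fun ξ => ∫ r in Ioc 0 T, ‖2 * (pairingTerm (d r) (c r) ξ).re‖ := by
  have h1 := ENNReal.summable_toReal h.tsum_integral_lt_top.ne
  refine h1.congr fun ξ => ?_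
  rw [integral_norm_eq_lintegral_enorm (h.integrableOn_term ξ).1,
    Measure.restrict_congr_set Ioo_ae_eq_Ioc]

/-- Starting from one time with finite L₂ norm, the increment of each mode is bounded, uniformly in
t, by the time integral of its dual product term; these integrals are summable in ξ. -/
theorem exists_summable_bound (h : IsPrimitive T c d C)
    (h0 : ∀ᵐ t ∂(volume.restrict (Ioo 0 T)), Summable fun ξ => ∑ k, ‖c t ξ k‖ ^ 2) :
    ∃ b : (Fin n → ℤ) → ℝ, Summable b ∧ ∀ t ∈ Icc 0 T, ∀ ξ, ∑ k, ‖C t ξ k‖ ^ 2 ≤ b ξ := by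
  have hne : (volume.restrict (Ioo 0 T)) ≠ 0 := by
    rw [Ne, Measure.restrict_eq_zero, Real.volume_Ioo]
    simp [h.pos]
  have : (ae (volume.restrict (Ioo 0 T))).NeBot := ae_neBot.2 hne
  obtain ⟨s, hs1, hs2, hs3⟩ := (h.ae_eq.and (h0.and (ae_restrict_mem measurableSet_Ioo))).exists
  refine ⟨fun ξ => ∑ k, ‖C s ξ k‖ ^ 2 +
    ∫ r in Ioc 0 T, ‖2 * (pairingTerm (d r) (c r) ξ).re‖, ?_, fun t ht ξ => ?_⟩
  · rw [hs1]; exact hs2.add h.summable_integral_norm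
  · have key : ∀ p q, 0 ≤ p → p ≤ q → q ≤ T →
        |∑ k, ‖C q ξ k‖ ^ 2 - ∑ k, ‖C p ξ k‖ ^ 2| ≤
          ∫ r in Ioc 0 T, ‖2 * (pairingTerm (d r) (c r) ξ).re‖ := by
      intro p q hp hpq hq
      rw [h.sq_sub_sq hp hpq hq, ← Real.norm_eq_abs]
      refine (norm_integral_le_integral_norm _).trans ?_
      exact setIntegral_mono_set (h.integrableOn_term ξ).norm
        (Eventually.of_forall fun _ => norm_nonneg _)
        (Ioc_subset_Ioc hp hq).eventuallyLE
    rcases le_total s t with hst | hst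
    · have := (abs_le.1 (key s t hs3.1.le hst ht.2)).2
      linarith
    · have := (abs_le.1 (key t s ht.1 hst hs3.2.le)).1
      linarith

/-- The single-mode identities are summed over ξ; summability of the integrals of the norms permits
exchanging sum and time integral. -/
theorem hasSum_sq_sub_sq (h : IsPrimitive T c d C) {s t : ℝ} (hs : 0 ≤ s) (hst : s ≤ t)
    (ht : t ≤ T) :
    HasSum (fun ξ => ∑ k, ‖C t ξ k‖ ^ 2 - ∑ k, ‖C s ξ k‖ ^ 2)
      (2 * ∫ r in s..t, pairing (d r) (c r)) := by
  have hsub : Ioc s t ⊆ Ioc 0 T := Ioc_subset_Ioc hs ht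
  have h1 := hasSum_integral_of_summable_integral_norm (μ := volume.restrict (Ioc s t))
    (F := fun ξ r => 2 * (pairingTerm (d r) (c r) ξ).re)
    (fun ξ => (h.integrableOn_term ξ).mono_set hsub)
    (h.summable_integral_norm.of_nonneg_of_le
      (fun ξ => integral_nonneg fun _ => norm_nonneg _)
      (fun ξ => setIntegral_mono_set (h.integrableOn_term ξ).norm
        (Eventually.of_forall fun _ => norm_nonneg _) hsub.eventuallyLE))
  have h2 : ∫ r in Ioc s t, ∑' ξ, 2 * (pairingTerm (d r) (c r) ξ).re =
      2 * ∫ r in s..t, pairing (d r) (c r) := by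
    rw [intervalIntegral.integral_of_le hst, ← integral_const_mul]
    refine integral_congr_ae ?_
    have hae : ∀ᵐ r ∂(volume.restrict (Ioc s t)), Summable (pairingTerm (d r) (c r)) := by
      refine ae_restrict_of_ae_restrict_of_subset hsub ?_
      rw [← Measure.restrict_congr_set (Ioo_ae_eq_Ioc (μ := volume))]
      exact ae_summable_pairingTerm h.memL2_deriv h.memL2.toMemL2H
    filter_upwards [hae] with r hr
    rw [tsum_mul_left, pairing, Complex.re_tsum hr]
  rw [← h2]
  exact h1.congr_fun fun ξ => h.sq_sub_sq hs hst ht ξ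

end IsPrimitive

theorem exists_continuous_version (hT : 0 < T) {u : ℝ → VField n} {d : ℝ → Coeffs n}
    (hc : MemL2HSigma T 1 (fun t => fieldCoeff (u t))) (hd : MemL2H T (-1) d)
    (hw : ∀ ξ k, HasWeakDeriv T (fun t => fieldCoeff (u t) ξ k) (fun t => d t ξ k)) :
    ∃ v : ℝ → VField n, (∀ᵐ t ∂(volume.restrict (Ioo 0 T)), v t = u t) ∧
      ContinuousOn v (Icc 0 T) ∧ (∀ t ∈ Icc 0 T, MemHSigma 0 (fieldCoeff (v t))) ∧
      ∀ s t : ℝ, 0 ≤ s → s ≤ t → t ≤ T →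
        ‖v t‖ ^ 2 - ‖v s‖ ^ 2 = 2 * ∫ r in s..t, pairing (d r) (fieldCoeff (u r)) := by
  obtain ⟨C, hC⟩ := exists_isPrimitive hT hc (fun t ξ k => conj_fieldCoeff _ _ _) hd hw
  obtain ⟨b, hb, hCb⟩ := hC.exists_summable_bound
    (Eventually.of_forall fun t => (hasSum_norm_fieldCoeff_sq (u t)).summable)
  have hex : ∀ t, ∃ w : VField n, t ∈ Icc 0 T → fieldCoeff w = C t := fun t => by
    by_cases ht : t ∈ Icc 0 T
    · obtain ⟨w, hw⟩ := exists_fieldCoeff_eq (C t) (fun ξ k => hC.conj_coeff ht ξ k)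
        (hb.of_nonneg_of_le (fun ξ => Finset.sum_nonneg fun _ _ => sq_nonneg _) (hCb t ht))
      exact ⟨w, fun _ => hw⟩
    · exact ⟨0, fun h => absurd h ht⟩
  choose v hv using hex
  refine ⟨v, ?_, ?_, ?_, ?_⟩
  · filter_upwards [hC.ae_eq, ae_restrict_mem measurableSet_Ioo] with t h1 h2
    refine fieldCoeff_injective fun ξ k => ?_
    rw [hv t (Ioo_subset_Icc_self h2), h1]
  · intro t₀ ht₀
    have hsum : ∀ t ∈ Icc 0 T, ‖v t - v t₀‖ ^ 2 = ∑' ξ, ∑ k, ‖C t ξ k - C t₀ ξ k‖ ^ 2 :=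
      fun t ht => by
        rw [← (hasSum_norm_fieldCoeff_sq (v t - v t₀)).tsum_eq]
        simp only [fieldCoeff_sub, hv t ht, hv t₀ ht₀]
    -- Each mode is continuous, and |x − y|² ≤ 2|x|² + 2|y|² gives the majorant 4b, so Parseval and
    -- dominated convergence yield strong continuity.
    have hlim : Tendsto (fun t => ∑' ξ, ∑ k, ‖C t ξ k - C t₀ ξ k‖ ^ 2) (𝓝[Icc 0 T] t₀)
        (𝓝 (∑' _ξ : Fin n → ℤ, (0 : ℝ))) := by
      refine tendsto_tsum_of_dominated_convergence (bound := fun ξ => 4 * b ξ) (hb.mul_left 4)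
        (fun ξ => ?_) ?_
      · have : ContinuousWithinAt (fun t => ∑ k, ‖C t ξ k - C t₀ ξ k‖ ^ 2) (Icc 0 T) t₀ :=
          (continuousOn_finsetSum _ fun k _ =>
            (((hC.continuousOn ξ k).sub continuousOn_const).norm).pow 2) t₀ ht₀
        simpa [ContinuousWithinAt] using this
      · filter_upwards [self_mem_nhdsWithin] with t ht ξ
        rw [Real.norm_of_nonneg (Finset.sum_nonneg fun _ _ => sq_nonneg _)]
        calc _ ≤ ∑ k, (2 * ‖C t ξ k‖ ^ 2 + 2 * ‖C t₀ ξ k‖ ^ 2) := by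
              refine Finset.sum_le_sum fun k _ => ?_
              have := norm_sub_le (C t ξ k) (C t₀ ξ k)
              nlinarith [norm_nonneg (C t ξ k - C t₀ ξ k), sq_nonneg (‖C t ξ k‖ - ‖C t₀ ξ k‖)]
          _ = 2 * ∑ k, ‖C t ξ k‖ ^ 2 + 2 * ∑ k, ‖C t₀ ξ k‖ ^ 2 := by
              rw [Finset.sum_add_distrib, ← Finset.mul_sum, ← Finset.mul_sum]
          _ ≤ 4 * b ξ := by linarith [hCb t ht ξ, hCb t₀ ht₀ ξ]
    rw [tsum_zero] at hlim
    have hlim2 : Tendsto (fun t => ‖v t - v t₀‖ ^ 2) (𝓝[Icc 0 T] t₀) (𝓝 0) :=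
      hlim.congr' (by
        filter_upwards [self_mem_nhdsWithin] with t ht
        exact (hsum t ht).symm)
    have hlim3 : Tendsto (fun t => ‖v t - v t₀‖) (𝓝[Icc 0 T] t₀) (𝓝 0) := by
      have := (Real.continuous_sqrt.tendsto 0).comp hlim2
      simpa [Function.comp_def, Real.sqrt_sq (norm_nonneg _)] using this
    exact tendsto_iff_norm_sub_tendsto_zero.2 hlim3
  · intro t ht
    refine ⟨?_, ?_, ?_⟩
    · rw [sobolevNormSq_zero_fieldCoeff]; exact ENNReal.ofReal_lt_top
    · rw [hv t ht]; exact hC.meanZero ht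
    · rw [hv t ht]; exact hC.divFree ht
  · intro s t hs hst ht
    have h1 := (hasSum_norm_fieldCoeff_sq (v t)).sub (hasSum_norm_fieldCoeff_sq (v s))
    rw [hv t ⟨hs.trans hst, ht⟩, hv s ⟨hs, hst.trans ht⟩] at h1
    exact h1.unique (hC.hasSum_sq_sub_sq hs hst ht)

end ContinuousVersion

/-! ### Regularity of the time derivative and the tested equation -/

/-! ### Weak solutions -/

section Solutions

variable {n : ℕ} {T : ℝ}

theorem memL2H_advectionCoeff {u : ℝ → VField n}
    (hinf : MemLinftyHSigma T 0 (fun t => fieldCoeff (u t)))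
    (h1 : MemL2HSigma T 1 (fun t => fieldCoeff (u t)))
    (hS : MemL2HSigma T ((n : ℝ) / 2) (fun t => fieldCoeff (u t))) :
    MemL2H T (-1) (fun t => advectionCoeff (u t)) := by
  constructor
  · intro ξ k
    refine aemeasurable_of_hasSum
      (f := fun η t => advectionTerm (fieldCoeff (u t)) ξ η k) (fun η => ?_) ?_
    · exact ((Finset.aemeasurable_fun_sum _ fun j _ =>
        (h1.measurable η j).const_mul _).const_mul _).mul (h1.measurable (ξ - η) k)
    · filter_upwards [h1.ae_lt_top, h1.divFree] with t ht hd
      exact hasSum_advectionTerm ht hd ξ k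
  · obtain ⟨B, hB, hle⟩ := hinf.bounded
    calc _ ≤ ∫⁻ t in Ioo 0 T, ENNReal.ofReal (4 * 8 ^ n) * n ^ 3 * B *
          sobolevNormSq ((n : ℝ) / 2) (fieldCoeff (u t)) := by
          refine lintegral_mono_ae ?_
          filter_upwards [h1.ae_lt_top, h1.divFree, hle] with t ht hd hb
          refine (sobolevNormSq_advectionCoeff_le ht hd).trans ?_
          rw [mul_assoc _ B]
          gcongr
      _ = ENNReal.ofReal (4 * 8 ^ n) * n ^ 3 * B *
          ∫⁻ t in Ioo 0 T, sobolevNormSq ((n : ℝ) / 2) (fieldCoeff (u t)) :=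
          lintegral_const_mul'' _ (aemeasurable_sobolevNormSq hS.measurable _)
      _ < ⊤ := ENNReal.mul_lt_top (ENNReal.mul_lt_top (ENNReal.mul_lt_top ENNReal.ofReal_lt_top
          (ENNReal.pow_lt_top (ENNReal.natCast_lt_top n))) hB) hS.finite

/-- The equation controls only the sum of u' and the projected advection term, and only on
solenoidal tests. That sum is estimated by duality, and the advection term is then subtracted. -/
theorem sobolevNormSq_deriv_le {a : Viscosity n} {t : ℝ} {M : ℝ≥0∞}
    (ha : ∀ᵐ x ∂(torusMeasure n), ∀ i j α β, ‖a i j α β (x, t)‖ₑ ≤ M)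
    {f d : Fin n → TorusDistribution n} {v : VField n} (hv : sobolevNormSq 1 (fieldCoeff v) < ⊤)
    (h0 : MeanZero (distCoeff d)) (hd : DivFree (distCoeff d))
    (heq : ∀ w : VField n, MemHSigma 1 (fieldCoeff w) →
      HasSum (pairingTerm (distCoeff d + leray (advectionCoeff v)) (fieldCoeff w))
        ((pairing (distCoeff f) (fieldCoeff w) - aForm a t v w : ℝ) : ℂ)) :
    sobolevNormSq (-1) (distCoeff d) ≤
      2 * (2 * sobolevNormSq (-1) (distCoeff f) +
        2 * ((M * (4 * (n : ℝ≥0∞) ^ 4)) ^ 2 * sobolevNormSq 1 (fieldCoeff v))) +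
      2 * (4 * sobolevNormSq (-1) (advectionCoeff v)) := by
  have hF : sobolevNormSq (-1) (distCoeff d + leray (advectionCoeff v)) ≤
      2 * sobolevNormSq (-1) (distCoeff f) +
        2 * ((M * (4 * (n : ℝ≥0∞) ^ 4)) ^ 2 * sobolevNormSq 1 (fieldCoeff v)) := by
    refine sobolevNormSq_neg_one_le_of_pairing_le (fun ξ k => ?_) (fun k => ?_) (fun ξ => ?_)
      fun w hw => ⟨_, heq w hw, ?_⟩
    · simp only [Pi.add_apply, map_add, conj_distCoeff, conj_leray (conj_advectionCoeff v)]
    · simp only [Pi.add_apply, h0 k, leray_meanZero _ k, add_zero]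
    · simp only [Pi.add_apply, mul_add, Finset.sum_add_distrib, hd ξ, leray_divFree _ ξ, add_zero]
    · refine (pow_le_pow_left₀ zero_le enorm_sub_le 2).trans
        ((add_sq_le_two_mul _ _).trans ?_)
      calc _ ≤ 2 * (sobolevNormSq (-1) (distCoeff f) * sobolevNormSq 1 (fieldCoeff w)) +
            2 * ((M * (4 * (n : ℝ≥0∞) ^ 4)) ^ 2 *
              (sobolevNormSq 1 (fieldCoeff v) * sobolevNormSq 1 (fieldCoeff w))) := by
            gcongr
            · exact enorm_pairing_sq_le 1 _ _
            · exact enorm_aForm_sq_le ha hv hw.finite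
        _ = _ := by ring
  have e : distCoeff d =
      distCoeff d + leray (advectionCoeff v) - leray (advectionCoeff v) := by
    rw [add_sub_cancel_right]
  rw [e]
  refine (sobolevNormSq_sub_le _ _ _).trans ?_
  gcongr
  exact sobolevNormSq_leray_le _ _

theorem pairing_deriv_eq {a : Viscosity n} {t : ℝ} {f d : Coeffs n} {v : VField n}
    (hv : MemHSigma 1 (fieldCoeff v)) (hv2 : sobolevNormSq ((n : ℝ) / 2) (fieldCoeff v) < ⊤)
    (heq : HasSum (pairingTerm (d + leray (advectionCoeff v)) (fieldCoeff v))
        ((pairing f (fieldCoeff v) - aForm a t v v : ℝ) : ℂ)) :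
    pairing d (fieldCoeff v) = pairing f (fieldCoeff v) - aForm a t v v := by
  have h1 := heq.sub (hasSum_pairingTerm_advection_zero hv.finite hv2 hv.divFree)
  have h2 : ∀ ξ, pairingTerm d (fieldCoeff v) ξ =
      pairingTerm (d + leray (advectionCoeff v)) (fieldCoeff v) ξ -
        pairingTerm (advectionCoeff v) (fieldCoeff v) ξ := fun ξ => by
    rw [← pairingTerm_leray (advectionCoeff v) hv.meanZero hv.divFree]
    simp only [pairingTerm, Pi.add_apply, add_mul, Finset.sum_add_distrib, add_sub_cancel_right]
  have h3 := (h1.congr_fun h2).tsum_eq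
  rw [pairing, h3, sub_zero, Complex.ofReal_re]

theorem IsSerrinSolution.memL2HSigma_deriv {a : Viscosity n} (ha : a.Bounded T)
    {f : ℝ → Fin n → TorusDistribution n} (hf : MemL2HDot T (-1) (fun t => distCoeff (f t)))
    {u₀ : VField n} {u : ℝ → VField n} (hu : IsSerrinSolution T a f u₀ u)
    {u' : ℝ → Fin n → TorusDistribution n} (hu' : IsTimeDeriv T u u')
    (heq : ∀ᵐ t ∂(volume.restrict (Ioo 0 T)), ∀ w : VField n, MemHSigma 1 (fieldCoeff w) →
      HasSum
        (pairingTerm (distCoeff (u' t) + leray (advectionCoeff (u t))) (fieldCoeff w))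
        ((pairing (distCoeff (f t)) (fieldCoeff w) - aForm a t (u t) w : ℝ) : ℂ)) :
    MemL2HSigma T (-1) (fun t => distCoeff (u' t)) := by
  have hadv := memL2H_advectionCoeff hu.memLinfty hu.memL2 hu.memL2Serrin
  have h0 := ae_meanZero_of_hasWeakDeriv hu.memL2.toMemL2HDot hu'.hasWeakDeriv
  have hd := ae_divFree_of_hasWeakDeriv hu.memL2 hu'.hasWeakDeriv
  obtain ⟨M, hM, hMa⟩ := ha.exists_ae_enorm_le
  refine ⟨⟨⟨fun ξ k => (hu' ξ k).1.aestronglyMeasurable.aemeasurable, ?_⟩, h0⟩, hd⟩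
  have mf := aemeasurable_sobolevNormSq hf.measurable (-1)
  have mu := aemeasurable_sobolevNormSq hu.memL2.measurable 1
  have ma := aemeasurable_sobolevNormSq hadv.measurable (-1)
  have mfu : AEMeasurable (fun t => 2 * sobolevNormSq (-1) (distCoeff (f t)) +
      2 * ((M * (4 * (n : ℝ≥0∞) ^ 4)) ^ 2 * sobolevNormSq 1 (fieldCoeff (u t))))
      (volume.restrict (Ioo 0 T)) := (mf.const_mul 2).add ((mu.const_mul _).const_mul 2)
  calc _ ≤ ∫⁻ t in Ioo 0 T, (2 * (2 * sobolevNormSq (-1) (distCoeff (f t)) +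
        2 * ((M * (4 * (n : ℝ≥0∞) ^ 4)) ^ 2 * sobolevNormSq 1 (fieldCoeff (u t)))) +
        2 * (4 * sobolevNormSq (-1) (advectionCoeff (u t)))) := by
        refine lintegral_mono_ae ?_
        filter_upwards [h0, hd, hMa, heq, hu.memL2.ae_lt_top] with t g1 g2 g3 g4 g5
        exact sobolevNormSq_deriv_le g3 g5 g1 g2 g4
    _ = 2 * (2 * (∫⁻ t in Ioo 0 T, sobolevNormSq (-1) (distCoeff (f t))) +
        2 * ((M * (4 * (n : ℝ≥0∞) ^ 4)) ^ 2 *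
          ∫⁻ t in Ioo 0 T, sobolevNormSq 1 (fieldCoeff (u t)))) +
        2 * (4 * ∫⁻ t in Ioo 0 T, sobolevNormSq (-1) (advectionCoeff (u t))) := by
        rw [lintegral_add_left' (mfu.const_mul 2),
          lintegral_const_mul'' _ mfu,
          lintegral_add_left' (mf.const_mul 2), lintegral_const_mul'' _ mf,
          lintegral_const_mul'' _ (mu.const_mul _), lintegral_const_mul'' _ mu,
          lintegral_const_mul'' _ (ma.const_mul _), lintegral_const_mul'' _ ma]
    _ < ⊤ := by
        have hn : (n : ℝ≥0∞) ^ 4 < ⊤ := ENNReal.pow_lt_top (ENNReal.natCast_lt_top n)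
        have hK : (M * (4 * (n : ℝ≥0∞) ^ 4)) ^ 2 < ⊤ :=
          ENNReal.pow_lt_top (ENNReal.mul_lt_top hM (ENNReal.mul_lt_top (by norm_num) hn))
        have h2 : (2 : ℝ≥0∞) < ⊤ := by norm_num
        have h4 : (4 : ℝ≥0∞) < ⊤ := by norm_num
        exact ENNReal.add_lt_top.2 ⟨ENNReal.mul_lt_top h2 (ENNReal.add_lt_top.2
          ⟨ENNReal.mul_lt_top h2 hf.finite,
            ENNReal.mul_lt_top h2 (ENNReal.mul_lt_top hK hu.memL2.finite)⟩),
          ENNReal.mul_lt_top h2 (ENNReal.mul_lt_top h4 hadv.finite)⟩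

/-- Testing the initial condition with v(0) and then with u₀ gives ‖v(0)‖² = ⟨u₀, v(0)⟩ = ‖u₀‖². -/
theorem norm_eq_of_isWeaklyContinuousVersion {u v : ℝ → VField n} {u₀ : VField n}
    (hinit : ∀ v : ℝ → VField n, IsWeaklyContinuousVersion T u v →
      ∀ w : VField n, MemHSigma 0 (fieldCoeff w) → inner ℝ (v 0) w = inner ℝ u₀ w)
    (hv : IsWeaklyContinuousVersion T u v) (hv0 : MemHSigma 0 (fieldCoeff (v 0)))
    (hu₀ : MemHSigma 0 (fieldCoeff u₀)) : ‖v 0‖ ^ 2 = ‖u₀‖ ^ 2 := by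
  rw [← real_inner_self_eq_norm_sq, ← real_inner_self_eq_norm_sq, hinit v hv _ hv0,
    real_inner_comm, hinit v hv _ hu₀]

end Solutions

end PeriodicNS

/-! ### Assembly of the energy equality -/

theorem mainTheorem3 (n : ℕ) (hn : 2 ≤ n) (T : ℝ) (hT : 0 < T)
    (a : PeriodicNS.Viscosity n) (ha : a.Bounded T)
    (f : ℝ → Fin n → PeriodicNS.TorusDistribution n)
    (hf : PeriodicNS.MemL2HDot T (-1) (fun t => PeriodicNS.distCoeff (f t)))
    (u₀ : PeriodicNS.VField n) (hu₀ : PeriodicNS.MemHSigma 0 (PeriodicNS.fieldCoeff u₀))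
    (u : ℝ → PeriodicNS.VField n) (hu : PeriodicNS.IsSerrinSolution T a f u₀ u) :
    -- `(u·∇)u ∈ L₂(0,T; H⁻¹)` and `u' ∈ L₂(0,T; Ḣ⁻¹_σ)`
    PeriodicNS.MemL2H T (-1) (fun t => PeriodicNS.advectionCoeff (u t)) ∧
    (∀ u' : ℝ → Fin n → PeriodicNS.TorusDistribution n, PeriodicNS.IsTimeDeriv T u u' →
      PeriodicNS.MemL2HSigma T (-1) (fun t => PeriodicNS.distCoeff (u' t))) ∧
    -- `v` is the continuous version of `u`
    ∃ v : ℝ → PeriodicNS.VField n,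
      (∀ᵐ t ∂(volume.restrict (Ioo 0 T)), v t = u t) ∧
      ContinuousOn v (Icc 0 T) ∧
      (∀ t ∈ Icc 0 T, PeriodicNS.MemHSigma 0 (PeriodicNS.fieldCoeff (v t))) ∧
      -- the integrals in the energy equality exist
      IntervalIntegrable (fun τ => PeriodicNS.aForm a τ (v τ) (v τ)) volume 0 T ∧
      IntervalIntegrable (fun τ => PeriodicNS.pairing (PeriodicNS.distCoeff (f τ))
        (PeriodicNS.fieldCoeff (v τ))) volume 0 T ∧
      -- the energy equality on every `[t₀, t] ⊆ [0, T]`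
      (∀ t₀ t : ℝ, 0 ≤ t₀ → t₀ ≤ t → t ≤ T →
        1 / 2 * ‖v t‖ ^ 2 + ∫ τ in t₀..t, PeriodicNS.aForm a τ (v τ) (v τ) =
          1 / 2 * ‖v t₀‖ ^ 2 + ∫ τ in t₀..t, PeriodicNS.pairing (PeriodicNS.distCoeff (f τ))
            (PeriodicNS.fieldCoeff (v τ))) ∧
      -- the energy equality from the initial datum
      (∀ t ∈ Icc 0 T,
        1 / 2 * ‖v t‖ ^ 2 + ∫ τ in (0 : ℝ)..t, PeriodicNS.aForm a τ (v τ) (v τ) =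
          1 / 2 * ‖u₀‖ ^ 2 + ∫ τ in (0 : ℝ)..t, PeriodicNS.pairing (PeriodicNS.distCoeff (f τ))
            (PeriodicNS.fieldCoeff (v τ))) := by

  open PeriodicNS in
  obtain ⟨d, hd, heq⟩ := hu.equation
  have hdL := hu.memL2HSigma_deriv ha hf hd heq
  obtain ⟨v, hvu, hvc, hvm, hve⟩ := exists_continuous_version hT hu.memL2 hdL.toMemL2H
    hd.hasWeakDeriv
  have hpd : IntegrableOn (fun t => pairing (distCoeff (d t)) (fieldCoeff (u t))) (Ioo 0 T) :=
    integrableOn_pairing hdL.toMemL2H hu.memL2.toMemL2H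
  have hpf : IntegrableOn (fun t => pairing (distCoeff (f t)) (fieldCoeff (v t))) (Ioo 0 T) := by
    refine Integrable.congr (integrableOn_pairing hf.toMemL2H hu.memL2.toMemL2H) ?_
    filter_upwards [hvu] with t ht
    rw [ht]
  have hid : ∀ᵐ t ∂(volume.restrict (Ioo 0 T)),
      pairing (distCoeff (f t)) (fieldCoeff (v t)) - pairing (distCoeff (d t)) (fieldCoeff (u t)) =
        aForm a t (v t) (v t) := by
    -- The exceptional null set in the equation does not depend on w, so w = u(t) may be chosen
    -- separately at each remaining time.
    filter_upwards [hvu, heq, hu.memL2.ae_lt_top, hu.memL2.meanZero, hu.memL2.divFree,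
      hu.memL2Serrin.ae_lt_top] with t h1 h2 h3 h4 h5 h6
    rw [h1, pairing_deriv_eq ⟨h3, h4, h5⟩ h6 (h2 (u t) ⟨h3, h4, h5⟩), sub_sub_cancel]
  -- Measurability and integrability of the viscous term in time are read off from the tested
  -- equation, which expresses it through two integrable dual products.
  have hpa : IntegrableOn (fun t => aForm a t (v t) (v t)) (Ioo 0 T) :=
    (hpf.sub hpd).congr hid
  have hia := intervalIntegrable_of_integrableOn_Ioo hT.le hpa
  have hif := intervalIntegrable_of_integrableOn_Ioo hT.le hpf
  have hi_d := intervalIntegrable_of_integrableOn_Ioo hT.le hpd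
  have henergy : ∀ t₀ t : ℝ, 0 ≤ t₀ → t₀ ≤ t → t ≤ T →
      1 / 2 * ‖v t‖ ^ 2 + ∫ τ in t₀..t, aForm a τ (v τ) (v τ) =
        1 / 2 * ‖v t₀‖ ^ 2 + ∫ τ in t₀..t, pairing (distCoeff (f τ)) (fieldCoeff (v τ)) := by
    intro t₀ t h0 hle ht
    have hsub : uIcc t₀ t ⊆ uIcc 0 T := by
      rw [uIcc_of_le hT.le]
      exact uIcc_subset_Icc ⟨h0, hle.trans ht⟩ ⟨h0.trans hle, ht⟩
    have e1 : ∫ τ in t₀..t, aForm a τ (v τ) (v τ) =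
        (∫ τ in t₀..t, pairing (distCoeff (f τ)) (fieldCoeff (v τ))) -
          ∫ τ in t₀..t, pairing (distCoeff (d τ)) (fieldCoeff (u τ)) := by
      rw [← intervalIntegral.integral_sub (hif.mono_set hsub) (hi_d.mono_set hsub),
        intervalIntegral.integral_of_le hle, intervalIntegral.integral_of_le hle]
      refine integral_congr_ae ?_
      refine ae_restrict_of_ae_restrict_of_subset (Ioc_subset_Ioc h0 ht) ?_
      rw [← Measure.restrict_congr_set (Ioo_ae_eq_Ioc (μ := volume))]
      filter_upwards [hid] with τ hτ
      exact hτ.symm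
    have e2 := hve t₀ t h0 hle ht
    linarith
  have hnorm : ‖v 0‖ ^ 2 = ‖u₀‖ ^ 2 :=
    norm_eq_of_isWeaklyContinuousVersion hu.initial
      ⟨hvu, fun w => hvc.inner continuousOn_const⟩ (hvm 0 ⟨le_rfl, hT.le⟩) hu₀
  refine ⟨memL2H_advectionCoeff hu.memLinfty hu.memL2 hu.memL2Serrin, fun u' hu' => ?_,
    v, hvu, hvc, hvm, hia, hif, henergy, fun t ht => ?_⟩
  -- Any other time derivative of `u` has the same coefficients almost everywhere as the one in the
  -- equation, so the bound transfers.
  · exact ⟨⟨hdL.toMemL2H.congr_ae (ae_eq_of_hasWeakDeriv hd.hasWeakDeriv hu'.hasWeakDeriv),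
      ae_meanZero_of_hasWeakDeriv hu.memL2.toMemL2HDot hu'.hasWeakDeriv⟩,
      ae_divFree_of_hasWeakDeriv hu.memL2 hu'.hasWeakDeriv⟩
  · rw [← hnorm]
    exact henergy 0 t le_rfl ht.1 ht.2
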